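/- **Setting.** Let $A=[a_{ij}]\in\mathbb R^{n\times n}$ be a nonnegative matrix and let $\mathcal G$ be the digraph on $\{1,\dots,n\}$ with an edge $(j,i)$ if and only if $a_{ij}>0$. Let $B=[b_{ij}]\in\mathbb R^{n\times n}$ satisfy, for $i\neq j$, $b_{ij}>0$ if $a_{ij}>0$ and $b_{ij}=0$ otherwise, together with $b_{jj}>0$ and $\sum_{i=1}^n b_{ij}=1$ for every $j$. Let $0<T<2$, $\epsilon>0$, $\alpha_k>0$, and let $f_1,\dots,f_n:\mathbb R^s\to\mathbb R$ be convex and differentiable, $f=\sum_{i=1}^n f_i$. From arbitrary initial states $r_i(0),q_i(0),y_i(0)\in\mathbb R^s$, consider for $k\ge 0$ $$r_i(k+1)=r_i(k)+T q_i(k),\qquad q_i(k+1)=q_i(k)+T u_i(k),$$ $$u_i(k)=-q_i(k)+\sum_{j}a_{ij}\big[(r_j(k)-r_i(k))+(q_j(k)-q_i(k))\big]+\epsilon y_i(k),$$ $$y_i(k+1)=-T\sum_{j}a_{ij}\big[(r_j(k)-r_i(k))+(q_j(k)-q_i(k))\big]+\sum_{j}b_{ij}y_j(k)-\epsilon T y_i(k)-\alpha_k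 T d_i(k),$$ where $w_i(k)=r_i(k)+q_i(k)+\sum_j b_{ij}y_j(k)$, and $d_i(k)=0$ if $1/\sqrt{\alpha_k}<\|\nabla f_i(w_i(k))\|^2$, $d_i(k)=\nabla f_i(w_i(k))$ otherwise. **Theorem.** Assume that $\mathcal G$ is strongly connected (it may be unbalanced) and that $\frac1T-\sum_j a_{ij}>0$ for every $i$. Then there is $\epsilon_0>0$, depending only on $A$, $B$ and $T$, such that the following holds whenever $0<\epsilon<\epsilon_0$ and $\epsilon<\frac1T-\sum_j a_{ij}$ for every $i$. If each set $X_i=\{x\in\mathbb R^s:\nabla f_i(x)=0\}$ is nonempty and bounded, and $(\alpha_k)$ is nonincreasing with $\sum_k\alpha_k=\infty$ and $\sum_k\alpha_k^2<\infty$, then $\lim_{k\to\infty}(r_i(k)-r_j(k))=0$ and $\lim_{k\to\infty}q_i(k)=0$ for all $i,j$, and there is a global minimizer $x^*$ of $f$ over $\mathbb R^s$ such that $\lim_{k\to\infty}r_i(k)=x^*$ for all $i$. (The gradients $\nabla f_i$ are not assumed to be bounded.) -/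

import Mathlib

open Filter Topology

noncomputable section

namespace SurplusOpt

/-- `ℝˢ` with the Euclidean norm. -/
abbrev Vec (s : ℕ) : Type := EuclideanSpace ℝ (Fin s)

/-- The digraph of a weight matrix has the edge `(j, i)` exactly when `0 < A i j`. -/
def Edge {n : ℕ} (A : Matrix (Fin n) (Fin n) ℝ) (j i : Fin n) : Prop := 0 < A i j

/-- Every node can be reached from every other node along a directed path. -/
def StronglyConnected {n : ℕ} (A : Matrix (Fin n) (Fin n) ℝ) : Prop :=
  ∀ i j : Fin n, Relation.ReflTransGen (Edge A) i j

/-- The column-stochastic weights through which the surplus variables are exchanged: for `i ≠ j`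
the entry `B i j` is positive when `i` is an out-neighbour of `j` and zero otherwise, the diagonal
is positive, and every column sums to one. -/
structure IsSurplusWeight {n : ℕ} (A B : Matrix (Fin n) (Fin n) ℝ) : Prop where
  pos_of_edge : ∀ i j, i ≠ j → Edge A j i → 0 < B i j
  zero_of_not_edge : ∀ i j, i ≠ j → ¬ Edge A j i → B i j = 0
  diag_pos : ∀ i, 0 < B i i
  col_sum : ∀ j, ∑ i, B i j = 1

/-- The zero set `X_i` of the gradient of a private objective function. -/
def gradZeros {s : ℕ} (g : Vec s → ℝ) : Set (Vec s) := {x | gradient g x = 0}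

/-- The team objective function. -/
def teamObjective {n s : ℕ} (f : Fin n → Vec s → ℝ) (x : Vec s) : ℝ := ∑ i, f i x

/-- The set of (global) minimizers of the team objective function. -/
def optimalSet {n s : ℕ} (f : Fin n → Vec s → ℝ) : Set (Vec s) :=
  {x | ∀ z, teamObjective f x ≤ teamObjective f z}

open Classical in
/-- The gradient-truncation switch with step size `a`, evaluated at `w`. -/
def truncGrad {s : ℕ} (a : ℝ) (g : Vec s → ℝ) (w : Vec s) : Vec s :=
  if 1 / Real.sqrt a < ‖gradient g w‖ ^ 2 then 0 else gradient g w

/-- The auxiliary point `w_i = r_i + q_i + ∑_j b_ij y_j`. -/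
def auxPoint {n s : ℕ} (B : Matrix (Fin n) (Fin n) ℝ) (r q y : Fin n → Vec s) (i : Fin n) :
    Vec s :=
  r i + q i + ∑ j, B i j • y j

/-- The coupling term `∑_j a_ij ((r_j - r_i) + (q_j - q_i))`. -/
def coupling {n s : ℕ} (A : Matrix (Fin n) (Fin n) ℝ) (r q : Fin n → Vec s) (i : Fin n) :
    Vec s :=
  ∑ j, A i j • ((r j - r i) + (q j - q i))

/-- The control input of agent `i`. -/
def control {n s : ℕ} (A : Matrix (Fin n) (Fin n) ℝ) (ε : ℝ) (r q y : Fin n → Vec s)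
    (i : Fin n) : Vec s :=
  -q i + coupling A r q i + ε • y i

/-- `(r, q, y)` is a trajectory of the second-order network with sampling time `T` under the
surplus-based algorithm (with arbitrary initial states); the first argument of `r`, `q`, `y` is
the discrete time. -/
structure IsTrajectory {n s : ℕ} (A B : Matrix (Fin n) (Fin n) ℝ) (T ε : ℝ) (α : ℕ → ℝ)
    (f : Fin n → Vec s → ℝ) (r q y : ℕ → Fin n → Vec s) : Prop where
  position : ∀ k i, r (k + 1) i = r k i + T • q k i
  velocity : ∀ k i, q (k + 1) i = q k i + T • control A ε (r k) (q k) (y k) i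
  surplus : ∀ k i, y (k + 1) i =
    -(T • coupling A (r k) (q k) i) + ∑ j, B i j • y k j - (ε * T) • y k i
      - (α k * T) • truncGrad (α k) (f i) (auxPoint B (r k) (q k) (y k) i)

end SurplusOpt

end

open Filter Topology

noncomputable section

namespace SurplusOpt

/-! ### Primitive nonnegative matrices and their Perron vectors. -/

section Positivity

variable {ι : Type*} [Fintype ι] [DecidableEq ι]

/-! Put x = r + q, P = 1 - TL (L the Laplacian of A) and δ = εT. The velocity damping cancels in x,
and the algorithm becomes x⁺ = Px + δy, y⁺ = x - Px + By - δy - αTd. Since B is column-stochastic,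
the linear part preserves ∑ x + ∑ y, so the average X of this total obeys X⁺ = X - (T/n) α ∑ d: a
gradient step with equal weights, whatever the left Perron vector of P. This is why balance is not
needed (`IsTrajectory.totalAverage_step`).

The disagreement (x - X, y) lies in the space of zero total. There the linear part is a contraction
for small δ (`exists_joint_norm`). At δ = 0 it is triangular: P contracts x modulo constants, B
contracts the zero-sum part of y, and only the drift ∑ wᵢxᵢ is neutral (w the left Perron vector of
P). For δ > 0 the zero total forces ∑ y to oppose the drift, which damps it at rate δκ;
`exists_coupling_weights` balances the three components. All constants are independent of the space
of states, hence so is the bound on ε.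

What remains is inexact gradient descent (`IsPerturbedDescent`), studied through ‖X - z‖² + 2N²/(1 -
l), where N is the norm of the disagreement. Truncation gives α‖d‖² ≤ √α, which replaces a gradient
bound: with coercivity of each fᵢ it bounds X (`IsPerturbedDescent.exists_bound`). Gradients are
then bounded along the trajectory, truncation eventually stops acting, and the usual quasi-Fejér
argument gives convergence to a minimizer (`IsPerturbedDescent.exists_tendsto`). Finally r follows r
+ q because |1 - T| < 1. -/

theorem pow_entry_nonneg {M : Matrix ι ι ℝ} (hM : ∀ i j, 0 ≤ M i j) (k : ℕ) (i j : ι) :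
    0 ≤ (M ^ k) i j := by
  induction k generalizing i j with
  | zero => rw [pow_zero, Matrix.one_apply]; split_ifs <;> norm_num
  | succ k ih =>
    rw [pow_succ, Matrix.mul_apply]
    exact Finset.sum_nonneg fun l _ => mul_nonneg (ih i l) (hM l j)

theorem pow_succ_entry_pos {M : Matrix ι ι ℝ} (hM : ∀ i j, 0 ≤ M i j) {k : ℕ} {i j l : ι}
    (h : 0 < (M ^ k) j l) (hij : 0 < M i j) : 0 < (M ^ (k + 1)) i l := by
  rw [pow_succ', Matrix.mul_apply]
  exact Finset.sum_pos' (fun a _ => mul_nonneg (hM i a) (pow_entry_nonneg hM k a l))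
    ⟨j, Finset.mem_univ _, mul_pos hij h⟩

theorem pow_entry_pos_of_le {M : Matrix ι ι ℝ} (hM : ∀ i j, 0 ≤ M i j)
    (hdiag : ∀ i, 0 < M i i) {k m : ℕ} (hkm : k ≤ m) {i j : ι} (h : 0 < (M ^ k) i j) :
    0 < (M ^ m) i j := by
  induction m, hkm using Nat.le_induction with
  | base => exact h
  | succ m _ ih => exact pow_succ_entry_pos hM ih (hdiag i)

/-- A nonnegative matrix with positive diagonal that is positive along the edges of a strongly
connected digraph is primitive. -/
theorem exists_pow_pos {n : ℕ} {A M : Matrix (Fin n) (Fin n) ℝ} (hconn : StronglyConnected A)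
    (hM : ∀ i j, 0 ≤ M i j) (hdiag : ∀ i, 0 < M i i)
    (hedge : ∀ i j, i ≠ j → Edge A j i → 0 < M i j) :
    ∃ m, 1 ≤ m ∧ ∀ i j, 0 < (M ^ m) i j := by
  have key : ∀ j i, ∃ k, 0 < (M ^ k) i j := by
    intro j i
    induction hconn j i with
    | refl => exact ⟨0, by simp⟩
    | @tail b c _ hbc ih =>
      obtain ⟨k, hk⟩ := ih
      refine ⟨k + 1, pow_succ_entry_pos hM hk ?_⟩
      by_cases h : c = b
      · rw [h]; exact hdiag b
      · exact hedge c b h hbc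
  choose k hk using key
  -- The positive diagonal preserves positive entries under further powers, so one exponent above
  -- all path lengths serves every pair.
  refine ⟨(∑ j, ∑ i, k j i) + 1, by omega, fun i j => pow_entry_pos_of_le hM hdiag ?_ (hk j i)⟩
  have h1 : k j i ≤ ∑ i, k j i :=
    Finset.single_le_sum (f := fun i => k j i) (fun _ _ => Nat.zero_le _) (Finset.mem_univ i)
  have h2 : ∑ i, k j i ≤ ∑ j, ∑ i, k j i :=
    Finset.single_le_sum (f := fun j => ∑ i, k j i) (fun _ _ => Nat.zero_le _) (Finset.mem_univ j)
  omega

theorem pow_col_sum {M : Matrix ι ι ℝ} (hcol : ∀ j, ∑ i, M i j = 1) (k : ℕ) (j : ι) :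
    ∑ i, (M ^ k) i j = 1 := by
  induction k generalizing j with
  | zero => simp [Matrix.one_apply]
  | succ k ih =>
    simp_rw [pow_succ, Matrix.mul_apply]
    rw [Finset.sum_comm]
    simp_rw [← Finset.sum_mul, ih, one_mul, hcol]

/-- The Perron vector of a primitive column-stochastic matrix. -/
theorem exists_stationary [Nonempty ι] {M : Matrix ι ι ℝ} (hM : ∀ i j, 0 ≤ M i j)
    (hcol : ∀ j, ∑ i, M i j = 1) {m : ℕ} (hm : ∀ i j, 0 < (M ^ m) i j) :
    ∃ v : ι → ℝ, (∀ i, 0 < v i) ∧ ∑ i, v i = 1 ∧ ∀ i, ∑ j, M i j * v j = v i := by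
  -- The all-ones row is a left null vector of M - 1, so a right one exists.
  have hdet : (M - 1).det = 0 := by
    rw [← Matrix.exists_vecMul_eq_zero_iff]
    refine ⟨fun _ => 1, fun h => one_ne_zero (congrFun h (Classical.arbitrary ι)), ?_⟩
    ext j
    simp [Matrix.vecMul, dotProduct, Matrix.one_apply, hcol]
  obtain ⟨u, hu0, hu⟩ := Matrix.exists_mulVec_eq_zero_iff.2 hdet
  have hu' : ∀ i, ∑ j, M i j * u j = u i := by
    intro i
    have := congrFun hu i
    rw [Matrix.sub_mulVec, Matrix.one_mulVec] at this
    simpa [Matrix.mulVec, dotProduct, sub_eq_zero] using this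
  -- Unit column sums give both sides the same total over i, so these inequalities are equalities
  -- and |u| is itself stationary.
  have hle : ∀ i, |u i| ≤ ∑ j, M i j * |u j| := by
    intro i
    calc |u i| = |∑ j, M i j * u j| := by rw [hu' i]
      _ ≤ ∑ j, |M i j * u j| := Finset.abs_sum_le_sum_abs _ _
      _ = ∑ j, M i j * |u j| := by simp_rw [abs_mul, abs_of_nonneg (hM _ _)]
  have hsum : ∑ i, ∑ j, M i j * |u j| = ∑ i, |u i| := by
    rw [Finset.sum_comm]
    simp_rw [← Finset.sum_mul, hcol, one_mul]
  have heq : ∀ i, ∑ j, M i j * |u j| = |u i| := fun i =>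
    (((Finset.sum_eq_sum_iff_of_le fun i _ => hle i).1 hsum.symm) i (Finset.mem_univ i)).symm
  have hpow : ∀ k i, ∑ j, (M ^ k) i j * |u j| = |u i| := by
    intro k
    induction k with
    | zero => intro i; simp [Matrix.one_apply]
    | succ k ih =>
      intro i
      simp_rw [pow_succ, Matrix.mul_apply, Finset.sum_mul]
      rw [Finset.sum_comm]
      simp_rw [mul_assoc, ← Finset.mul_sum, heq, ih]
  obtain ⟨l, hl⟩ : ∃ l, u l ≠ 0 := by
    by_contra! h
    exact hu0 (funext h)
  have hpos : ∀ i, 0 < |u i| := by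
    intro i
    rw [← hpow m i]
    exact Finset.sum_pos' (fun j _ => mul_nonneg (hm i j).le (abs_nonneg _))
      ⟨l, Finset.mem_univ _, mul_pos (hm i l) (abs_pos.2 hl)⟩
  have hS : 0 < ∑ i, |u i| := Finset.sum_pos (fun i _ => hpos i) Finset.univ_nonempty
  refine ⟨fun i => |u i| / ∑ i, |u i|, fun i => div_pos (hpos i) hS, ?_, fun i => ?_⟩
  · rw [← Finset.sum_div, div_self hS.ne']
  · simp_rw [← mul_div_assoc]
    rw [← Finset.sum_div, heq]

end Positivity

/-! ### Contraction of zero-sum families by a column-stochastic matrix. -/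

section Contraction

variable {ι : Type*} [Fintype ι] {E : Type*} [NormedAddCommGroup E] [NormedSpace ℝ E]

/-- The action of a real matrix on families of vectors. -/
def mix (M : Matrix ι ι ℝ) : (ι → E) →ₗ[ℝ] (ι → E) where
  toFun x i := ∑ j, M i j • x j
  map_add' x y := by ext i; simp [Finset.sum_add_distrib]
  map_smul' c x := by
    ext i
    simp only [Pi.smul_apply, RingHom.id_apply, Finset.smul_sum]
    exact Finset.sum_congr rfl fun j _ => smul_comm _ _ _

theorem mix_apply (M : Matrix ι ι ℝ) (x : ι → E) (i : ι) : mix M x i = ∑ j, M i j • x j := rfl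

theorem mix_mul (M N : Matrix ι ι ℝ) (x : ι → E) : mix (M * N) x = mix M (mix N x) := by
  ext i
  simp only [mix_apply, Matrix.mul_apply, Finset.sum_smul, Finset.smul_sum, smul_smul]
  exact Finset.sum_comm

theorem mix_one [DecidableEq ι] (x : ι → E) : mix (1 : Matrix ι ι ℝ) x = x := by
  ext i
  simp [mix_apply, Matrix.one_apply]

theorem sum_mix {M : Matrix ι ι ℝ} (hcol : ∀ j, ∑ i, M i j = 1) (x : ι → E) :
    ∑ i, mix M x i = ∑ i, x i := by
  simp_rw [mix_apply]
  rw [Finset.sum_comm]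
  simp_rw [← Finset.sum_smul, hcol, one_smul]

theorem sum_norm_mix_le {M : Matrix ι ι ℝ} (hM : ∀ i j, 0 ≤ M i j) {c : ℝ}
    (hcol : ∀ j, ∑ i, M i j = c) (x : ι → E) : ∑ i, ‖mix M x i‖ ≤ c * ∑ i, ‖x i‖ := by
  calc ∑ i, ‖mix M x i‖ ≤ ∑ i, ∑ j, M i j * ‖x j‖ := by
        refine Finset.sum_le_sum fun i _ => (norm_sum_le _ _).trans_eq ?_
        simp_rw [norm_smul, Real.norm_of_nonneg (hM _ _)]
    _ = c * ∑ i, ‖x i‖ := by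
        rw [Finset.sum_comm, Finset.mul_sum]
        simp_rw [← Finset.sum_mul, hcol]

/-- The `ℓ¹` seminorm of a family of vectors. -/
def sumNorm (ι : Type*) [Fintype ι] (E : Type*) [NormedAddCommGroup E] [NormedSpace ℝ E] :
    Seminorm ℝ (ι → E) :=
  Seminorm.of (fun x => ∑ i, ‖x i‖)
    (fun x y => by
      rw [← Finset.sum_add_distrib]
      exact Finset.sum_le_sum fun i _ => norm_add_le _ _)
    (fun c x => by simp [norm_smul, Finset.mul_sum])

theorem sumNorm_apply (x : ι → E) : sumNorm ι E x = ∑ i, ‖x i‖ := rfl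

/-- A primitive column-stochastic matrix contracts the zero-sum families in a seminorm equivalent
to the `ℓ¹` seminorm, uniformly over all normed spaces. -/
theorem exists_contracting_seminorm [DecidableEq ι] [Nonempty ι] {M : Matrix ι ι ℝ}
    (hM : ∀ i j, 0 ≤ M i j) (hcol : ∀ j, ∑ i, M i j = 1) {m : ℕ} (hm1 : 1 ≤ m)
    (hm : ∀ i j, 0 < (M ^ m) i j) :
    ∃ ρ K : ℝ, 0 ≤ ρ ∧ ρ < 1 ∧ 1 ≤ K ∧
      ∀ (E : Type) [NormedAddCommGroup E] [NormedSpace ℝ E], ∃ N : Seminorm ℝ (ι → E),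
        (∀ x, ∑ i, x i = 0 → N (mix M x) ≤ ρ * N x) ∧
        (∀ x, sumNorm ι E x ≤ N x) ∧ (∀ x, N x ≤ K * sumNorm ι E x) := by
  obtain ⟨μ, hμ, hμle⟩ : ∃ μ : ℝ, 0 < μ ∧ ∀ i j, μ ≤ (M ^ m) i j := by
    obtain ⟨p, hp⟩ := Finite.exists_min fun p : ι × ι => (M ^ m) p.1 p.2
    exact ⟨_, hm p.1 p.2, fun i j => hp (i, j)⟩
  set c : ℝ := Fintype.card ι * μ with hc
  have hc0 : 0 < c := mul_pos (by exact_mod_cast Fintype.card_pos) hμ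
  have hc1 : c ≤ 1 := by
    rw [← pow_col_sum hcol m (Classical.arbitrary ι), hc, ← nsmul_eq_mul]
    exact Finset.card_nsmul_le_sum _ _ _ fun i _ => hμle i _
  have hmpos : (0 : ℝ) < m := by exact_mod_cast hm1
  have hm1' : (1 : ℝ) ≤ m := by exact_mod_cast hm1
  -- The seminorm sums the ℓ¹ norms of the first m iterates. One application of M telescopes and
  -- loses ‖x‖ - ‖Mᵐx‖ ≥ c‖x‖, which is at least the fraction c/m of the whole.
  refine ⟨1 - c / m, m, ?_, ?_, hm1', fun E _ _ => ?_⟩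
  · rw [sub_nonneg, div_le_one hmpos]; linarith
  · have := div_pos hc0 hmpos; linarith
  set N : Seminorm ℝ (ι → E) :=
    Seminorm.of (fun x => ∑ k ∈ Finset.range m, sumNorm ι E (mix (M ^ k) x))
      (fun x y => by
        rw [← Finset.sum_add_distrib]
        exact Finset.sum_le_sum fun k _ => by rw [map_add]; exact map_add_le_add _ _ _)
      (fun a x => by
        rw [Finset.mul_sum]
        exact Finset.sum_congr rfl fun k _ => by rw [map_smul, map_smul_eq_mul]) with hN
  have hNap : ∀ x, N x = ∑ k ∈ Finset.range m, sumNorm ι E (mix (M ^ k) x) := fun x => rfl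
  have hup : ∀ x, N x ≤ m * sumNorm ι E x := by
    intro x
    calc N x ≤ ∑ k ∈ Finset.range m, sumNorm ι E x := by
          rw [hNap]
          refine Finset.sum_le_sum fun k _ => ?_
          simpa only [sumNorm_apply, one_mul] using
            sum_norm_mix_le (pow_entry_nonneg hM k) (pow_col_sum hcol k) x
      _ = m * sumNorm ι E x := by simp
  refine ⟨N, fun x hx => ?_, fun x => ?_, hup⟩
  · have hstep : sumNorm ι E (mix (M ^ m) x) ≤ (1 - c) * sumNorm ι E x := by
      -- Doeblin's trick: a constant matrix kills zero-sum families, and subtracting it leaves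
      -- nonnegative entries with column sums 1 - c.
      have h1 : mix (M ^ m) x = mix (M ^ m - Matrix.of fun _ _ => μ) x := by
        ext i
        simp [mix_apply, sub_smul, ← Finset.smul_sum, hx]
      rw [h1, sumNorm_apply, sumNorm_apply]
      refine sum_norm_mix_le (fun i j => by simpa using hμle i j) (fun j => ?_) x
      simp [pow_col_sum hcol, hc]
    have htel : N (mix M x) = N x + sumNorm ι E (mix (M ^ m) x) - sumNorm ι E x := by
      have h1 : N (mix M x) = ∑ k ∈ Finset.range m, sumNorm ι E (mix (M ^ (k + 1)) x) := by
        rw [hNap]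
        exact Finset.sum_congr rfl fun k _ => by rw [pow_succ, mix_mul]
      have h2 := Finset.sum_range_succ (fun k => sumNorm ι E (mix (M ^ k) x)) m
      rw [Finset.sum_range_succ'] at h2
      rw [h1, hNap, ← h2, pow_zero, mix_one]
      ring
    have h3 : c / m * N x ≤ c * sumNorm ι E x := by
      calc c / m * N x ≤ c / m * (m * sumNorm ι E x) :=
            mul_le_mul_of_nonneg_left (hup x) (div_pos hc0 hmpos).le
        _ = c * sumNorm ι E x := by field_simp
    rw [htel]
    linarith
  · rw [hNap]
    have h := Finset.single_le_sum (f := fun k => sumNorm ι E (mix (M ^ k) x))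
      (fun k _ => apply_nonneg _ _) (Finset.mem_range.2 hm1)
    simpa [mix_one] using h

end Contraction

/-! ### One step of the coupled iteration in drift and disagreement coordinates. -/

section Joint

/-- A weighted sum handles a system that is triangular at δ = 0. The weight β is small enough for
the damping δκ of a to pay for the leak of a into b, and γ is small relative to β so that the decay
of b pays for the O(1) leak of b into c. Both are fixed before δ, which then only has to make the
remaining terms small. -/
theorem exists_coupling_weights {C κ ρ : ℝ} (hC : 1 ≤ C) (hκ : 0 < κ) (hρ0 : 0 ≤ ρ) (hρ1 : ρ < 1) :
    ∃ β γ δ₀ : ℝ, 0 < β ∧ 0 < γ ∧ 0 < δ₀ ∧ δ₀ * κ ≤ 1 ∧ ∀ δ, 0 < δ → δ < δ₀ →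
      ∃ l : ℝ, 0 ≤ l ∧ l < 1 ∧ ∀ a b c a' b' c' : ℝ, 0 ≤ a → 0 ≤ b → 0 ≤ c →
        a' ≤ (1 - δ * κ) * a + δ * C * (b + c) →
        b' ≤ ρ * b + δ * C * (a + b + c) →
        c' ≤ ρ * c + C * b + δ * C * c →
        a' + β * b' + γ * c' ≤ l * (a + β * b + γ * c) := by
  have hC0 : 0 < C := by linarith
  have hr : 0 < 1 - ρ := by linarith
  obtain ⟨β, hβ, hβC⟩ : ∃ β : ℝ, 0 < β ∧ β * C = κ / 2 :=
    ⟨κ / (2 * C), by positivity, by field_simp⟩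
  obtain ⟨γ, hγ, hγC⟩ : ∃ γ : ℝ, 0 < γ ∧ γ * C = β * (1 - ρ) / 2 :=
    ⟨β * (1 - ρ) / (2 * C), by positivity, by field_simp⟩
  refine ⟨β, γ, min (1 / κ) (min (β * (1 - ρ) / (4 * (C * (1 + β))))
    (γ * (1 - ρ) / (2 * (C * (1 + β + γ))))), hβ, hγ, by positivity, ?_, ?_⟩
  · calc _ ≤ 1 / κ * κ := mul_le_mul_of_nonneg_right (min_le_left _ _) hκ.le
      _ = 1 := by field_simp
  intro δ hδ0 hδ
  obtain ⟨h1, h23⟩ := lt_min_iff.1 hδ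
  obtain ⟨h2, h3⟩ := lt_min_iff.1 h23
  rw [lt_div_iff₀ (by positivity)] at h1 h2 h3
  -- The coefficient of a retains half its damping. In b the leak into c costs (1 - ρ)/2 and the
  -- δ-terms (1 - ρ)/4, leaving (3 + ρ)/4; c does no worse.
  refine ⟨max (1 - δ * κ / 2) ((3 + ρ) / 4), le_max_of_le_right (by linarith),
    max_lt (by nlinarith [mul_pos hδ0 hκ]) (by linarith), ?_⟩
  intro a b c a' b' c' ha hb hc ha' hb' hc'
  set l := max (1 - δ * κ / 2) ((3 + ρ) / 4) with hl
  have hl1 : 1 - δ * κ / 2 ≤ l := le_max_left _ _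
  have hl2 : (3 + ρ) / 4 ≤ l := le_max_right _ _
  have e1 : a * (1 - δ * κ + β * (δ * C)) ≤ l * a := by
    have : 1 - δ * κ + β * (δ * C) ≤ l := by
      have : β * (δ * C) = δ * (κ / 2) := by rw [← hβC]; ring
      linarith
    nlinarith
  have e2 : b * (δ * C + β * ρ + β * (δ * C) + γ * C) ≤ l * (β * b) := by
    have : δ * C + β * ρ + β * (δ * C) + γ * C ≤ l * β := by nlinarith
    nlinarith
  have e3 : c * (δ * C + β * (δ * C) + γ * ρ + γ * (δ * C)) ≤ l * (γ * c) := by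
    have : δ * C + β * (δ * C) + γ * ρ + γ * (δ * C) ≤ l * γ := by nlinarith
    nlinarith
  have f2 := mul_le_mul_of_nonneg_left hb' hβ.le
  have f3 := mul_le_mul_of_nonneg_left hc' hγ.le
  linarith

variable {ι : Type*} [Fintype ι]

/-- With D = diag(w), stationarity of w makes D P D⁻¹ column-stochastic, and D carries families of
zero w-average to zero-sum families. The seminorm is the column-stochastic one pulled back by D. -/
theorem exists_contracting_seminorm_of_row [DecidableEq ι] [Nonempty ι] {P : Matrix ι ι ℝ} {w : ι → ℝ}
    (hP : ∀ i j, 0 ≤ P i j) (hw : ∀ i, 0 < w i) (hst : ∀ j, ∑ i, w i * P i j = w j)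
    {m : ℕ} (hm1 : 1 ≤ m)
    (hm : ∀ i j, 0 < ((Matrix.of fun i j => w i * P i j / w j : Matrix ι ι ℝ) ^ m) i j) :
    ∃ ρ K : ℝ, 0 ≤ ρ ∧ ρ < 1 ∧ 1 ≤ K ∧
      ∀ (E : Type) [NormedAddCommGroup E] [NormedSpace ℝ E], ∃ N : Seminorm ℝ (ι → E),
        (∀ x, ∑ i, w i • x i = 0 → N (mix P x) ≤ ρ * N x) ∧
        (∀ x, sumNorm ι E x ≤ K * N x) ∧ (∀ x, N x ≤ K * sumNorm ι E x) := by
  obtain ⟨ρ, K, hρ0, hρ1, hK, H⟩ := exists_contracting_seminorm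
    (M := Matrix.of fun i j => w i * P i j / w j)
    (fun i j => div_nonneg (mul_nonneg (hw i).le (hP i j)) (hw j).le)
    (fun j => by
      simp only [Matrix.of_apply]
      rw [← Finset.sum_div, hst, div_self (hw j).ne']) hm1 hm
  set S := ∑ i, w i with hS
  set R := ∑ i, (w i)⁻¹ with hR
  have hwS : ∀ i, w i ≤ S := fun i =>
    Finset.single_le_sum (f := w) (fun i _ => (hw i).le) (Finset.mem_univ i)
  have hwR : ∀ i, (w i)⁻¹ ≤ R := fun i =>
    Finset.single_le_sum (f := fun i => (w i)⁻¹) (fun i _ => (inv_pos.2 (hw i)).le)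
      (Finset.mem_univ i)
  have hK0 : 0 ≤ K := by linarith
  refine ⟨ρ, max K (max R (K * S)), hρ0, hρ1, le_max_of_le_left hK, fun E _ _ => ?_⟩
  obtain ⟨N, h1, h2, h3⟩ := H E
  have hD : ∀ x : ι → E, mix (Matrix.diagonal w) x = fun i => w i • x i := by
    intro x
    ext i
    simp [mix_apply, Matrix.diagonal_apply]
  refine ⟨N.comp (mix (Matrix.diagonal w)), fun x hx => ?_, fun x => ?_, fun x => ?_⟩
  · have := h1 (mix (Matrix.diagonal w) x) (by rw [hD]; exact hx)
    rw [← mix_mul] at this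
    rw [Seminorm.comp_apply, Seminorm.comp_apply, ← mix_mul]
    convert this using 4
    ext i j
    simp [Matrix.diagonal_mul, Matrix.mul_diagonal, (hw j).ne']
  · rw [Seminorm.comp_apply]
    refine le_trans ?_ (mul_le_mul_of_nonneg_right
      ((le_max_left R _).trans (le_max_right K _)) (apply_nonneg N _))
    refine le_trans ?_ (mul_le_mul_of_nonneg_left (h2 _)
      ((inv_pos.2 (hw (Classical.arbitrary ι))).le.trans (hwR _)))
    rw [hD, sumNorm_apply, sumNorm_apply, Finset.mul_sum]
    refine Finset.sum_le_sum fun i _ => ?_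
    rw [norm_smul, Real.norm_of_nonneg (hw i).le]
    calc ‖x i‖ = (w i)⁻¹ * (w i * ‖x i‖) := by rw [inv_mul_cancel_left₀ (hw i).ne']
      _ ≤ R * (w i * ‖x i‖) :=
        mul_le_mul_of_nonneg_right (hwR i) (mul_nonneg (hw i).le (norm_nonneg _))
  · rw [Seminorm.comp_apply]
    refine le_trans (h3 _) (le_trans ?_ (mul_le_mul_of_nonneg_right
      ((le_max_right R _).trans (le_max_right K _)) (apply_nonneg (sumNorm ι E) x)))
    rw [mul_assoc]
    refine mul_le_mul_of_nonneg_left ?_ hK0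
    rw [hD, sumNorm_apply, sumNorm_apply, Finset.mul_sum]
    refine Finset.sum_le_sum fun i _ => ?_
    rw [norm_smul, Real.norm_of_nonneg (hw i).le]
    exact mul_le_mul_of_nonneg_right (hwS i) (norm_nonneg _)

theorem norm_sum_smul_le {E : Type*} [NormedAddCommGroup E] [NormedSpace ℝ E] {w : ι → ℝ}
    (hw : ∀ i, 0 < w i) (hw1 : ∑ i, w i = 1) (x : ι → E) :
    ‖∑ i, w i • x i‖ ≤ sumNorm ι E x := by
  refine (norm_sum_le _ _).trans (Finset.sum_le_sum fun i _ => ?_)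
  rw [norm_smul, Real.norm_of_nonneg (hw i).le]
  refine mul_le_of_le_one_left (norm_nonneg _) ?_
  rw [← hw1]
  exact Finset.single_le_sum (f := w) (fun i _ => (hw i).le) (Finset.mem_univ i)

theorem sumNorm_const {E : Type*} [NormedAddCommGroup E] [NormedSpace ℝ E] (a : E) :
    sumNorm ι E (fun _ => a) = Fintype.card ι * ‖a‖ := by
  simp [sumNorm_apply]

theorem sumNorm_smul_vec {E : Type*} [NormedAddCommGroup E] [NormedSpace ℝ E] {v : ι → ℝ}
    (hv : ∀ i, 0 < v i) (hv1 : ∑ i, v i = 1) (a : E) :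
    sumNorm ι E (fun i => v i • a) = ‖a‖ := by
  simp_rw [sumNorm_apply, norm_smul, Real.norm_of_nonneg (hv _).le]
  rw [← Finset.sum_mul, hv1, one_mul]

set_option maxHeartbeats 1000000 in
/-- The consensus part `(x - 𝟙 ∑ wᵢxᵢ, y - v ∑ yᵢ)` of a state, together with the drift
`∑ wᵢxᵢ`: one step of the surplus iteration is bounded by a triangular system. -/
theorem joint_step {E : Type} [NormedAddCommGroup E] [NormedSpace ℝ E] {P B : Matrix ι ι ℝ}
    {w v : ι → ℝ} (hrow : ∀ i, ∑ j, P i j = 1)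
    (hw : ∀ i, 0 < w i) (hw1 : ∑ i, w i = 1) (hwP : ∀ j, ∑ i, w i * P i j = w j)
    (hcol : ∀ j, ∑ i, B i j = 1)
    (hv : ∀ i, 0 < v i) (hv1 : ∑ i, v i = 1) (hBv : ∀ i, ∑ j, B i j * v j = v i)
    {ρ K : ℝ} (hρ1 : ρ < 1) (hK : 1 ≤ K) {N₁ N₂ : Seminorm ℝ (ι → E)}
    (h11 : ∀ x, ∑ i, w i • x i = 0 → N₁ (mix P x) ≤ ρ * N₁ x)
    (h12 : ∀ x, sumNorm ι E x ≤ K * N₁ x) (h13 : ∀ x, N₁ x ≤ K * sumNorm ι E x)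
    (h21 : ∀ x, ∑ i, x i = 0 → N₂ (mix B x) ≤ ρ * N₂ x)
    (h22 : ∀ x, sumNorm ι E x ≤ K * N₂ x) (h23 : ∀ x, N₂ x ≤ K * sumNorm ι E x)
    {κ C δ : ℝ} (hκ : κ = Fintype.card ι * ∑ i, w i * v i)
    (hC : C = 4 * K ^ 2 * (1 + Fintype.card ι) ^ 2) (hδ : 0 ≤ δ) (hδκ : δ * κ ≤ 1)
    (x y x' y' : ι → E) (hxy : ∑ i, x i + ∑ i, y i = 0)
    (hx' : x' = mix P x + δ • y) (hy' : y' = x - mix P x + mix B y - δ • y)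
    {xt yt xt' yt' : ι → E} (hxt : xt = fun i => x i - ∑ j, w j • x j)
    (hyt : yt = fun i => y i - v i • ∑ j, y j)
    (hxt' : xt' = fun i => x' i - ∑ j, w j • x' j)
    (hyt' : yt' = fun i => y' i - v i • ∑ j, y' j) :
    ‖∑ j, w j • x' j‖ ≤ (1 - δ * κ) * ‖∑ j, w j • x j‖ + δ * C * (N₁ xt + N₂ yt) ∧
    N₁ xt' ≤ ρ * N₁ xt + δ * C * (‖∑ j, w j • x j‖ + N₁ xt + N₂ yt) ∧
    N₂ yt' ≤ ρ * N₂ yt + C * N₁ xt + δ * C * N₂ yt := by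
  set c : ℝ := (Fintype.card ι : ℝ) with hc
  have hc0 : 0 ≤ c := Nat.cast_nonneg _
  set ξ := ∑ j, w j • x j with hξ
  set η := ∑ j, y j with hη
  set p := ∑ i, w i * v i with hp
  set a := ‖ξ‖ with ha
  set b := N₁ xt with hb
  set d := N₂ yt with hd
  have ha0 : 0 ≤ a := norm_nonneg _
  have hb0 : 0 ≤ b := apply_nonneg _ _
  have hd0 : 0 ≤ d := apply_nonneg _ _
  have hK2 : K ≤ K ^ 2 := by nlinarith
  have hC1 : 4 * K ^ 2 ≤ C := by rw [hC]; nlinarith [mul_nonneg hc0 hc0, sq_nonneg K]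
  have hCK : K ≤ C := by nlinarith
  have hC2 : K ^ 2 * (1 + c) ^ 2 ≤ C := by rw [hC]; nlinarith [mul_nonneg hc0 hc0, sq_nonneg K]
  have hp1 : p ≤ 1 := by
    rw [← hv1]
    refine Finset.sum_le_sum fun i _ => mul_le_of_le_one_left (hv i).le ?_
    rw [← hw1]
    exact Finset.single_le_sum (f := w) (fun i _ => (hw i).le) (Finset.mem_univ i)
  have hp0 : 0 ≤ p := Finset.sum_nonneg fun i _ => (mul_pos (hw i) (hv i)).le
  have hxtx : x = xt + fun _ => ξ := by ext i; simp [hxt]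
  have hyty : y = yt + fun i => v i • η := by ext i; simp [hyt]
  have hxt0 : ∑ i, w i • xt i = 0 := by
    simp only [hxt, smul_sub, Finset.sum_sub_distrib]
    rw [← Finset.sum_smul, hw1, one_smul, sub_self]
  have hyt0 : ∑ i, yt i = 0 := by
    simp only [hyt, Finset.sum_sub_distrib]
    rw [← Finset.sum_smul, hv1, one_smul, sub_self]
  -- The zero total ties the surplus to the drift with a negative sign; this is the only source of
  -- damping for ξ.
  have hηeq : η = -(c • ξ + ∑ i, xt i) := by
    have : ∑ i, x i = c • ξ + ∑ i, xt i := by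
      conv_lhs => rw [hxtx]
      simp [Finset.sum_add_distrib, hc, add_comm, Nat.cast_smul_eq_nsmul]
    rw [← this]
    exact eq_neg_of_add_eq_zero_right hxy
  have hsxt : sumNorm ι E xt ≤ K * b := h12 xt
  have hsyt : sumNorm ι E yt ≤ K * d := h22 yt
  have hsum_xt : ‖∑ i, xt i‖ ≤ K * b := (norm_sum_le _ _).trans hsxt
  have hηn : ‖η‖ ≤ c * a + K * b := by
    rw [hηeq, norm_neg]
    refine (norm_add_le _ _).trans (add_le_add ?_ hsum_xt)
    rw [norm_smul, Real.norm_of_nonneg hc0]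
  have hyn : sumNorm ι E y ≤ c * a + K * b + K * d := by
    rw [hyty]
    refine (map_add_le_add _ _ _).trans ?_
    rw [sumNorm_smul_vec hv hv1]
    linarith
  have hPconst : ∀ e : E, mix P (fun _ => e) = fun _ => e := by
    intro e
    ext i
    rw [mix_apply, ← Finset.sum_smul, hrow, one_smul]
  have hwmix : ∀ z : ι → E, ∑ i, w i • mix P z i = ∑ i, w i • z i := by
    intro z
    simp_rw [mix_apply, Finset.smul_sum, smul_smul]
    rw [Finset.sum_comm]
    simp_rw [← Finset.sum_smul, hwP]
  have hwy : ∑ i, w i • y i = p • η + ∑ i, w i • yt i := by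
    conv_lhs => rw [hyty]
    simp only [Pi.add_apply, smul_add, Finset.sum_add_distrib, smul_smul]
    rw [← Finset.sum_smul, add_comm]
  have hξ' : ∑ j, w j • x' j = ξ + δ • ∑ i, w i • y i := by
    rw [hx']
    simp only [Pi.add_apply, Pi.smul_apply, smul_add, Finset.sum_add_distrib, hwmix,
      Finset.smul_sum, smul_comm δ]
    rfl
  refine ⟨?_, ?_, ?_⟩
  · have e : ∑ j, w j • x' j = (1 - δ * κ) • ξ + δ • (∑ i, w i • yt i - p • ∑ i, xt i) := by
      rw [hξ', hwy, hηeq, hκ]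
      module
    rw [e]
    have f1 : ‖p • ∑ i, xt i‖ ≤ K * b := by
      rw [norm_smul, Real.norm_of_nonneg hp0]
      exact (mul_le_of_le_one_left (norm_nonneg _) hp1).trans hsum_xt
    have f2 : ‖∑ i, w i • yt i‖ ≤ K * d := (norm_sum_smul_le hw hw1 yt).trans hsyt
    calc _ ≤ (1 - δ * κ) * a + δ * (K * d + K * b) := by
          refine (norm_add_le _ _).trans (add_le_add ?_ ?_)
          · rw [norm_smul, Real.norm_of_nonneg (by linarith)]
          · rw [norm_smul, Real.norm_of_nonneg hδ]
            exact mul_le_mul_of_nonneg_left ((norm_sub_le _ _).trans (add_le_add f2 f1)) hδ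
      _ ≤ _ := by
          have : K * d + K * b ≤ C * (b + d) := by nlinarith
          nlinarith
  · have e : xt' = mix P xt + δ • (y - fun _ => ∑ i, w i • y i) := by
      have : mix P x = mix P xt + fun _ => ξ := by
        conv_lhs => rw [hxtx]
        rw [map_add, hPconst]
      ext i
      simp only [hxt', hξ', Pi.add_apply, Pi.smul_apply, Pi.sub_apply]
      rw [hx', this]
      simp only [Pi.add_apply, Pi.smul_apply]
      module
    have f1 : N₁ (y - fun _ => ∑ i, w i • y i) ≤ C * (a + b + d) := by
      have g1 : sumNorm ι E (y - fun _ => ∑ i, w i • y i) ≤ (1 + c) * sumNorm ι E y := by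
        refine (map_sub_le_add _ _ _).trans ?_
        rw [sumNorm_const]
        have := mul_le_mul_of_nonneg_left (norm_sum_smul_le hw hw1 y) hc0
        linarith
      have g2 : (1 + c) * sumNorm ι E y ≤ (1 + c) * (c * a + K * b + K * d) :=
        mul_le_mul_of_nonneg_left hyn (by linarith)
      have g3 : c * a + K * b + K * d ≤ (1 + c) * K * (a + b + d) := by
        have hK0 : 0 ≤ K := by linarith
        have hK1 : 0 ≤ K - 1 := by linarith
        have : (1 + c) * K * (a + b + d) - (c * a + K * b + K * d)
            = K * a + c * (K - 1) * a + c * K * b + c * K * d := by ring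
        have : 0 ≤ K * a + c * (K - 1) * a + c * K * b + c * K * d := by positivity
        linarith
      have hs : 0 ≤ a + b + d := by positivity
      calc _ ≤ K * ((1 + c) * ((1 + c) * K * (a + b + d))) :=
            (h13 _).trans (mul_le_mul_of_nonneg_left (g1.trans (g2.trans
              (mul_le_mul_of_nonneg_left g3 (by linarith)))) (by linarith))
        _ = K ^ 2 * (1 + c) ^ 2 * (a + b + d) := by ring
        _ ≤ _ := mul_le_mul_of_nonneg_right hC2 hs
    rw [e]
    refine (map_add_le_add _ _ _).trans (add_le_add (h11 xt hxt0) ?_)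
    rw [map_smul_eq_mul, Real.norm_of_nonneg hδ, mul_assoc]
    exact mul_le_mul_of_nonneg_left f1 hδ
  -- P fixes constants, so the drift does not enter here; its effect through ∑ y lies along v and is
  -- projected out. Hence the third bound contains no drift term.
  · have hu : x - mix P x = xt - mix P xt := by
      conv_lhs => rw [hxtx]
      rw [map_add, hPconst]
      abel
    set u := xt - mix P xt with hudef
    have hBy : mix B y = mix B yt + fun i => v i • η := by
      conv_lhs => rw [hyty]
      rw [map_add]
      congr 1
      ext i
      simp_rw [mix_apply, smul_smul]
      rw [← Finset.sum_smul, hBv]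
    have hη' : ∑ j, y' j = ∑ j, u j + η - δ • η := by
      rw [hy', hu]
      simp only [Pi.add_apply, Pi.sub_apply, Pi.smul_apply, Finset.sum_add_distrib,
        Finset.sum_sub_distrib, sum_mix hcol, ← Finset.smul_sum]
      rfl
    have e : yt' = (u - fun i => v i • ∑ j, u j) + (mix B yt - δ • yt) := by
      ext i
      simp only [hyt', hη', Pi.add_apply, Pi.smul_apply, Pi.sub_apply]
      rw [hy', hu, hBy]
      simp only [hyt, Pi.add_apply, Pi.smul_apply, Pi.sub_apply]
      module
    have f1 : sumNorm ι E u ≤ 2 * K * b := by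
      refine (map_sub_le_add _ _ _).trans ?_
      have := (h12 (mix P xt)).trans (mul_le_mul_of_nonneg_left (h11 xt hxt0) (by linarith))
      nlinarith [mul_nonneg (by linarith : 0 ≤ K) hb0]
    have f2 : N₂ (u - fun i => v i • ∑ j, u j) ≤ C * b := by
      have g1 : sumNorm ι E (u - fun i => v i • ∑ j, u j) ≤ 2 * sumNorm ι E u := by
        refine (map_sub_le_add _ _ _).trans ?_
        rw [sumNorm_smul_vec hv hv1]
        have : ‖∑ j, u j‖ ≤ sumNorm ι E u := norm_sum_le _ _
        linarith
      calc _ ≤ K * (2 * (2 * K * b)) :=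
            (h23 _).trans (mul_le_mul_of_nonneg_left (by linarith) (by linarith))
        _ = 4 * K ^ 2 * b := by ring
        _ ≤ _ := mul_le_mul_of_nonneg_right hC1 hb0
    rw [e]
    refine (map_add_le_add _ _ _).trans ?_
    have f3 : N₂ (mix B yt - δ • yt) ≤ ρ * d + δ * d := by
      refine (map_sub_le_add _ _ _).trans (add_le_add (h21 yt hyt0) ?_)
      rw [map_smul_eq_mul, Real.norm_of_nonneg hδ]
    have f4 : δ * d ≤ δ * C * d := by
      have : 1 ≤ C := by linarith
      nlinarith [mul_nonneg hδ hd0]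
    linarith

end Joint

/-! ### The contracting norm for the network matrices. -/

section Network

variable {n : ℕ}

/-- The row-stochastic matrix `1 - T L` with `L` the Laplacian of the weights `A`. -/
def stepMatrix (A : Matrix (Fin n) (Fin n) ℝ) (T : ℝ) : Matrix (Fin n) (Fin n) ℝ :=
  Matrix.of fun i j => (if i = j then 1 - T * ∑ l, A i l else 0) + T * A i j

theorem stepMatrix_diag_pos {A : Matrix (Fin n) (Fin n) ℝ} {T : ℝ} (hA : ∀ i j, 0 ≤ A i j)
    (hT : 0 < T) (hTA : ∀ i, 0 < 1 / T - ∑ j, A i j) (i : Fin n) : 0 < stepMatrix A T i i := by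
  have h1 := mul_pos hT (hTA i)
  rw [mul_sub, mul_one_div_cancel hT.ne'] at h1
  have h2 := mul_nonneg hT.le (hA i i)
  simp only [stepMatrix, Matrix.of_apply, if_true]
  linarith

theorem stepMatrix_nonneg {A : Matrix (Fin n) (Fin n) ℝ} {T : ℝ} (hA : ∀ i j, 0 ≤ A i j)
    (hT : 0 < T) (hTA : ∀ i, 0 < 1 / T - ∑ j, A i j) (i j : Fin n) : 0 ≤ stepMatrix A T i j := by
  by_cases h : i = j
  · rw [← h]; exact (stepMatrix_diag_pos hA hT hTA i).le
  · simpa [stepMatrix, h] using mul_nonneg hT.le (hA i j)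

theorem stepMatrix_pos_of_edge {A : Matrix (Fin n) (Fin n) ℝ} {T : ℝ} (hT : 0 < T)
    (i j : Fin n) (h : i ≠ j) (he : Edge A j i) : 0 < stepMatrix A T i j := by
  simpa [stepMatrix, h] using mul_pos hT he

theorem stepMatrix_row_sum (A : Matrix (Fin n) (Fin n) ℝ) (T : ℝ) (i : Fin n) :
    ∑ j, stepMatrix A T i j = 1 := by
  simp [stepMatrix, Finset.sum_add_distrib, ← Finset.mul_sum]

theorem mix_stepMatrix {E : Type*} [NormedAddCommGroup E] [NormedSpace ℝ E]
    (A : Matrix (Fin n) (Fin n) ℝ) (T : ℝ) (x : Fin n → E) (i : Fin n) :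
    mix (stepMatrix A T) x i = x i + T • ∑ j, A i j • (x j - x i) := by
  simp only [mix_apply, stepMatrix, Matrix.of_apply, add_smul, ite_smul, zero_smul,
    Finset.sum_add_distrib, Finset.sum_ite_eq, Finset.mem_univ, if_true, smul_sub, mul_smul,
    Finset.sum_sub_distrib, sub_smul, one_smul, ← Finset.smul_sum, ← Finset.sum_smul]
  abel

theorem IsSurplusWeight.nonneg {A B : Matrix (Fin n) (Fin n) ℝ} (hB : IsSurplusWeight A B)
    (i j : Fin n) : 0 ≤ B i j := by
  by_cases h : i = j
  · rw [← h]; exact (hB.diag_pos i).le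
  · by_cases he : Edge A j i
    · exact (hB.pos_of_edge i j h he).le
    · exact (hB.zero_of_not_edge i j h he).ge

theorem norm_sub_weighted_le {E : Type*} [NormedAddCommGroup E] [NormedSpace ℝ E]
    {w : Fin n → ℝ} (hw : ∀ i, 0 < w i) (hw1 : ∑ i, w i = 1) (x : Fin n → E) :
    sumNorm (Fin n) E (fun i => x i - ∑ j, w j • x j) ≤ (1 + n) * sumNorm (Fin n) E x := by
  refine (map_sub_le_add (sumNorm (Fin n) E) x (fun _ => ∑ j, w j • x j)).trans ?_
  rw [sumNorm_const, Fintype.card_fin]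
  have := mul_le_mul_of_nonneg_left (norm_sum_smul_le hw hw1 x) (Nat.cast_nonneg (α := ℝ) n)
  linarith

/-- For a small surplus gain the surplus iteration contracts the states of zero total in a norm
that is equivalent to the standard one, with constants that do not depend on the space. -/
theorem exists_joint_norm (hn : 0 < n) {A B : Matrix (Fin n) (Fin n) ℝ} {T : ℝ}
    (hA : ∀ i j, 0 ≤ A i j) (hconn : StronglyConnected A) (hB : IsSurplusWeight A B)
    (hT : 0 < T) (hTA : ∀ i, 0 < 1 / T - ∑ j, A i j) :
    ∃ δ₀ : ℝ, 0 < δ₀ ∧ ∀ δ, 0 < δ → δ < δ₀ → ∃ l K : ℝ, 0 ≤ l ∧ l < 1 ∧ 0 < K ∧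
      ∀ (E : Type) [NormedAddCommGroup E] [NormedSpace ℝ E],
        ∃ N : (Fin n → E) → (Fin n → E) → ℝ,
          (∀ x y, 0 ≤ N x y) ∧
          (∀ x y x' y', N (x + x') (y + y') ≤ N x y + N x' y') ∧
          (∀ x y, ∑ i, x i + ∑ i, y i = 0 →
            N (mix (stepMatrix A T) x + δ • y)
              (x - mix (stepMatrix A T) x + mix B y - δ • y) ≤ l * N x y) ∧
          (∀ x y, ∑ i, x i + ∑ i, y i = 0 → ∑ i, ‖x i‖ + ∑ i, ‖y i‖ ≤ K * N x y) ∧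
          (∀ x y, N x y ≤ K * (∑ i, ‖x i‖ + ∑ i, ‖y i‖)) := by
  have : Nonempty (Fin n) := ⟨⟨0, hn⟩⟩
  set P := stepMatrix A T with hPdef
  have hP0 := stepMatrix_nonneg hA hT hTA
  have hPd := stepMatrix_diag_pos hA hT hTA
  have hPe := stepMatrix_pos_of_edge (A := A) hT
  have hrow := stepMatrix_row_sum A T
  obtain ⟨w, hw, hw1, hwP⟩ : ∃ w : Fin n → ℝ, (∀ i, 0 < w i) ∧ ∑ i, w i = 1 ∧
      ∀ j, ∑ i, w i * P i j = w j := by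
    obtain ⟨m, -, hm⟩ := exists_pow_pos hconn hP0 hPd hPe
    obtain ⟨w, h1, h2, h3⟩ := exists_stationary (M := P.transpose) (m := m)
      (fun i j => hP0 j i) hrow (fun i j => by rw [← Matrix.transpose_pow]; exact hm j i)
    exact ⟨w, h1, h2, fun j => by simpa [mul_comm] using h3 j⟩
  obtain ⟨v, hv, hv1, hBv, ρ₂, K₂, hρ₂, hρ₂', hK₂, H₂⟩ : ∃ v : Fin n → ℝ, (∀ i, 0 < v i) ∧
      ∑ i, v i = 1 ∧ (∀ i, ∑ j, B i j * v j = v i) ∧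
      ∃ ρ K : ℝ, 0 ≤ ρ ∧ ρ < 1 ∧ 1 ≤ K ∧
        ∀ (E : Type) [NormedAddCommGroup E] [NormedSpace ℝ E], ∃ N : Seminorm ℝ (Fin n → E),
          (∀ x, ∑ i, x i = 0 → N (mix B x) ≤ ρ * N x) ∧
          (∀ x, sumNorm (Fin n) E x ≤ N x) ∧ (∀ x, N x ≤ K * sumNorm (Fin n) E x) := by
    obtain ⟨m, hm1, hm⟩ := exists_pow_pos hconn hB.nonneg hB.diag_pos hB.pos_of_edge
    obtain ⟨v, h1, h2, h3⟩ := exists_stationary hB.nonneg hB.col_sum hm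
    exact ⟨v, h1, h2, h3, exists_contracting_seminorm hB.nonneg hB.col_sum hm1 hm⟩
  obtain ⟨ρ₁, K₁, hρ₁, hρ₁', hK₁, H₁⟩ : ∃ ρ K : ℝ, 0 ≤ ρ ∧ ρ < 1 ∧ 1 ≤ K ∧
      ∀ (E : Type) [NormedAddCommGroup E] [NormedSpace ℝ E], ∃ N : Seminorm ℝ (Fin n → E),
        (∀ x, ∑ i, w i • x i = 0 → N (mix P x) ≤ ρ * N x) ∧
        (∀ x, sumNorm (Fin n) E x ≤ K * N x) ∧ (∀ x, N x ≤ K * sumNorm (Fin n) E x) := by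
    -- Conjugation by the positive diagonal of w keeps the sign pattern of P, hence primitivity.
    obtain ⟨m, hm1, hm⟩ := exists_pow_pos
      (M := Matrix.of fun i j => w i * P i j / w j) hconn
      (fun i j => div_nonneg (mul_nonneg (hw i).le (hP0 i j)) (hw j).le)
      (fun i => div_pos (mul_pos (hw i) (hPd i)) (hw i))
      (fun i j h he => div_pos (mul_pos (hw i) (hPe i j h he)) (hw j))
    exact exists_contracting_seminorm_of_row hP0 hw hwP hm1 hm
  set ρ := max ρ₁ ρ₂ with hρ
  set K := max K₁ K₂ with hK
  have hK1 : 1 ≤ K := hK₁.trans (le_max_left _ _)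
  have hK0 : 0 < K := by linarith
  have hρ0 : 0 ≤ ρ := hρ₁.trans (le_max_left _ _)
  have hρ1 : ρ < 1 := max_lt hρ₁' hρ₂'
  set κ : ℝ := Fintype.card (Fin n) * ∑ i, w i * v i with hκ
  have hκ0 : 0 < κ := mul_pos (by exact_mod_cast Fintype.card_pos)
    (Finset.sum_pos (fun i _ => mul_pos (hw i) (hv i)) Finset.univ_nonempty)
  set C : ℝ := 4 * K ^ 2 * (1 + Fintype.card (Fin n)) ^ 2 with hC
  have hC1 : 1 ≤ C := by
    have hc : (0 : ℝ) ≤ Fintype.card (Fin n) := Nat.cast_nonneg _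
    rw [hC]
    exact one_le_mul_of_one_le_of_one_le (by nlinarith) (by nlinarith)
  obtain ⟨β, γ, δ₀, hβ, hγ, hδ₀, hδ₀κ, H⟩ := exists_coupling_weights hC1 hκ0 hρ0 hρ1
  refine ⟨δ₀, hδ₀, fun δ hδ hδlt => ?_⟩
  obtain ⟨l, hl0, hl1, Hl⟩ := H δ hδ hδlt
  -- The first bracket serves the lower bound on the norm, the second the upper bound.
  set K' : ℝ := (2 * n + 2 * K / β + K / γ) + (1 + β * (K * (1 + n)) + γ * (K * 2)) with hK'
  refine ⟨l, K', hl0, hl1, by positivity, fun E _ _ => ?_⟩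
  obtain ⟨N₁, h11, h12, h13⟩ := H₁ E
  obtain ⟨N₂, h21, h22, h23⟩ := H₂ E
  have h11' : ∀ x, ∑ i, w i • x i = 0 → N₁ (mix P x) ≤ ρ * N₁ x := fun x hx =>
    (h11 x hx).trans (mul_le_mul_of_nonneg_right (le_max_left _ _) (apply_nonneg _ _))
  have h12' : ∀ x, sumNorm (Fin n) E x ≤ K * N₁ x := fun x =>
    (h12 x).trans (mul_le_mul_of_nonneg_right (le_max_left _ _) (apply_nonneg _ _))
  have h13' : ∀ x, N₁ x ≤ K * sumNorm (Fin n) E x := fun x =>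
    (h13 x).trans (mul_le_mul_of_nonneg_right (le_max_left _ _) (apply_nonneg _ _))
  have h21' : ∀ x, ∑ i, x i = 0 → N₂ (mix B x) ≤ ρ * N₂ x := fun x hx =>
    (h21 x hx).trans (mul_le_mul_of_nonneg_right (le_max_right _ _) (apply_nonneg _ _))
  have h22' : ∀ x, sumNorm (Fin n) E x ≤ K * N₂ x := fun x =>
    (h22 x).trans (le_mul_of_one_le_left (apply_nonneg _ _) hK1)
  have h23' : ∀ x, N₂ x ≤ K * sumNorm (Fin n) E x := fun x =>
    (h23 x).trans (mul_le_mul_of_nonneg_right (le_max_right _ _) (apply_nonneg _ _))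
  refine ⟨fun x y => ‖∑ j, w j • x j‖ + β * N₁ (fun i => x i - ∑ j, w j • x j)
    + γ * N₂ (fun i => y i - v i • ∑ j, y j), fun x y => ?_, fun x y x' y' => ?_,
    fun x y hxy => ?_, fun x y hxy => ?_, fun x y => ?_⟩
  · have := apply_nonneg N₁ (fun i => x i - ∑ j, w j • x j)
    have := apply_nonneg N₂ (fun i => y i - v i • ∑ j, y j)
    positivity
  · have e0 : ∑ j, w j • (x + x') j = ∑ j, w j • x j + ∑ j, w j • x' j := by
      simp [Finset.sum_add_distrib]
    have e1 : (fun i => (x + x') i - ∑ j, w j • (x + x') j)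
        = (fun i => x i - ∑ j, w j • x j) + fun i => x' i - ∑ j, w j • x' j := by
      ext1 i
      rw [e0]
      simp only [Pi.add_apply]
      abel
    have e2 : (fun i => (y + y') i - v i • ∑ j, (y + y') j)
        = (fun i => y i - v i • ∑ j, y j) + fun i => y' i - v i • ∑ j, y' j := by
      ext1 i
      simp only [Pi.add_apply, Finset.sum_add_distrib, smul_add]
      abel
    simp only [e1, e2]
    rw [e0]
    have f0 := norm_add_le (∑ j, w j • x j) (∑ j, w j • x' j)
    have f1 := mul_le_mul_of_nonneg_left (map_add_le_add N₁ (fun i => x i - ∑ j, w j • x j)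
      fun i => x' i - ∑ j, w j • x' j) hβ.le
    have f2 := mul_le_mul_of_nonneg_left (map_add_le_add N₂ (fun i => y i - v i • ∑ j, y j)
      fun i => y' i - v i • ∑ j, y' j) hγ.le
    linarith
  · obtain ⟨g1, g2, g3⟩ := joint_step hrow hw hw1 hwP hB.col_sum hv hv1 hBv hρ1 hK1 h11' h12' h13'
      h21' h22' h23' hκ hC hδ.le ((mul_le_mul_of_nonneg_right hδlt.le hκ0.le).trans hδ₀κ)
      x y _ _ hxy rfl rfl rfl rfl rfl rfl
    exact Hl _ _ _ _ _ _ (norm_nonneg _) (apply_nonneg _ _) (apply_nonneg _ _) g1 g2 g3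
  · set ξ := ∑ j, w j • x j with hξ
    set xt : Fin n → E := fun i => x i - ξ with hxt
    set yt : Fin n → E := fun i => y i - v i • ∑ j, y j with hyt
    have e1 : x = xt + fun _ => ξ := by ext1 i; simp [hxt]
    have e2 : y = yt + fun i => v i • ∑ j, y j := by ext1 i; simp [hyt]
    have f1 : sumNorm (Fin n) E x ≤ K * N₁ xt + n * ‖ξ‖ := by
      conv_lhs => rw [e1]
      refine (map_add_le_add _ _ _).trans (add_le_add (h12' _) ?_)
      rw [sumNorm_const, Fintype.card_fin]
    -- The norm does not see ∑ y; the zero total replaces it by -∑ x.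
    have f2 : sumNorm (Fin n) E y ≤ K * N₂ yt + sumNorm (Fin n) E x := by
      conv_lhs => rw [e2]
      refine (map_add_le_add _ _ _).trans (add_le_add (h22' _) ?_)
      rw [sumNorm_smul_vec hv hv1, eq_neg_of_add_eq_zero_right hxy, norm_neg]
      exact norm_sum_le _ _
    have f3 : sumNorm (Fin n) E x + sumNorm (Fin n) E y
        ≤ 2 * n * ‖ξ‖ + 2 * K / β * (β * N₁ xt) + K / γ * (γ * N₂ yt) := by
      have g1 : 2 * K / β * (β * N₁ xt) = 2 * K * N₁ xt := by field_simp
      have g2 : K / γ * (γ * N₂ yt) = K * N₂ yt := by field_simp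
      rw [g1, g2]
      linarith
    refine f3.trans ?_
    have p0 := norm_nonneg ξ
    have p1 := mul_nonneg hβ.le (apply_nonneg N₁ xt)
    have p2 := mul_nonneg hγ.le (apply_nonneg N₂ yt)
    have q1 : 0 ≤ 2 * K / β := by positivity
    have q2 : 0 ≤ K / γ := by positivity
    have q3 : 0 ≤ 1 + β * (K * (1 + n)) + γ * (K * 2) := by positivity
    have q4 : (0 : ℝ) ≤ 2 * n := by positivity
    rw [mul_add, mul_add]
    exact add_le_add (add_le_add (mul_le_mul_of_nonneg_right (by linarith) p0)
      (mul_le_mul_of_nonneg_right (by linarith) p1)) (mul_le_mul_of_nonneg_right (by linarith) p2)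
  · have g0 := norm_sum_smul_le hw hw1 x
    have g1 : β * N₁ (fun i => x i - ∑ j, w j • x j)
        ≤ β * (K * (1 + n)) * sumNorm (Fin n) E x := by
      rw [mul_assoc, mul_assoc]
      exact mul_le_mul_of_nonneg_left ((h13' _).trans (mul_le_mul_of_nonneg_left
        (norm_sub_weighted_le hw hw1 x) hK0.le)) hβ.le
    have g2 : γ * N₂ (fun i => y i - v i • ∑ j, y j) ≤ γ * (K * 2) * sumNorm (Fin n) E y := by
      rw [mul_assoc, mul_assoc]
      refine mul_le_mul_of_nonneg_left ((h23' _).trans (mul_le_mul_of_nonneg_left ?_ hK0.le)) hγ.le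
      refine (map_sub_le_add (sumNorm (Fin n) E) y fun i => v i • ∑ j, y j).trans ?_
      rw [sumNorm_smul_vec hv hv1]
      have : ‖∑ j, y j‖ ≤ sumNorm (Fin n) E y := norm_sum_le _ _
      linarith
    have p1 := apply_nonneg (sumNorm (Fin n) E) x
    have p2 := apply_nonneg (sumNorm (Fin n) E) y
    have q1 : 1 + β * (K * (1 + n)) ≤ K' := by
      have : 0 ≤ 2 * n + 2 * K / β + K / γ := by positivity
      have : 0 ≤ γ * (K * 2) := by positivity
      linarith
    have q2 : γ * (K * 2) ≤ K' := by
      have : 0 ≤ 2 * n + 2 * K / β + K / γ := by positivity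
      have : 0 ≤ 1 + β * (K * (1 + n)) := by positivity
      linarith
    have r1 := mul_le_mul_of_nonneg_right q1 p1
    have r2 := mul_le_mul_of_nonneg_right q2 p2
    calc _ ≤ K' * (sumNorm (Fin n) E x) + K' * (sumNorm (Fin n) E y) := by linarith
      _ = _ := by rw [← mul_add]; rfl

end Network

/-! ### Gradients and coercivity of convex functions. -/

section Convex

variable {E : Type*} [NormedAddCommGroup E] [InnerProductSpace ℝ E] [CompleteSpace E]

open scoped RealInnerProductSpace

/-- The first-order characterisation of convexity. -/
theorem inner_gradient_le {g : E → ℝ} (hd : Differentiable ℝ g) (hc : ConvexOn ℝ Set.univ g)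
    (x z : E) : ⟪gradient g x, z - x⟫ ≤ g z - g x := by
  set φ : ℝ → ℝ := fun t => g (x + t • (z - x)) with hφ
  have hφd : HasDerivAt φ ⟪gradient g x, z - x⟫ 0 := by
    have h1 : HasFDerivAt g (InnerProductSpace.toDual ℝ E (gradient g x)) (x + (0 : ℝ) • (z - x)) := by
      rw [zero_smul, add_zero]
      exact (hd x).hasGradientAt.hasFDerivAt
    have h2 : HasDerivAt (fun t : ℝ => x + t • (z - x)) (z - x) 0 := by
      simpa using ((hasDerivAt_id (0 : ℝ)).smul_const (z - x)).const_add x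
    exact h1.comp_hasDerivAt (0 : ℝ) h2
  have hφc : ConvexOn ℝ Set.univ φ := by
    refine ⟨convex_univ, fun s _ t _ a b ha hb hab => ?_⟩
    have := hc.2 (Set.mem_univ (x + s • (z - x))) (Set.mem_univ (x + t • (z - x))) ha hb hab
    convert this using 2
    have hb' : b = 1 - a := by linarith
    rw [hb']
    simp only [smul_eq_mul]
    module
  have := hφc.le_slope_of_hasDerivAt (Set.mem_univ 0) (Set.mem_univ 1) one_pos hφd
  simpa [slope, hφ] using this

/-- One unit step along the normalized gradient raises g by at least ‖∇g‖, while |g| is bounded on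
the ball enlarged by 1. -/
theorem exists_gradient_bound [FiniteDimensional ℝ E] {g : E → ℝ} (hd : Differentiable ℝ g)
    (hc : ConvexOn ℝ Set.univ g) (z : E) (R : ℝ) :
    ∃ G, ∀ x, ‖x - z‖ ≤ R → ‖gradient g x‖ ≤ G := by
  obtain ⟨M, hM⟩ := (isCompact_closedBall z (R + 1)).exists_bound_of_continuousOn
    hd.continuous.continuousOn
  refine ⟨2 * M, fun x hx => ?_⟩
  by_cases h0 : gradient g x = 0
  · rw [h0, norm_zero]
    have := (norm_nonneg _).trans (hM x (by rw [mem_closedBall_iff_norm]; linarith))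
    linarith
  have hpos : 0 < ‖gradient g x‖ := norm_pos_iff.2 h0
  set u : E := ‖gradient g x‖⁻¹ • gradient g x with hu
  have hun : ‖u‖ = 1 := by rw [hu, norm_smul, norm_inv, norm_norm, inv_mul_cancel₀ hpos.ne']
  have h1 := inner_gradient_le hd hc x (x + u)
  rw [add_sub_cancel_left, hu, real_inner_smul_right, real_inner_self_eq_norm_sq, ← hu, sq,
    inv_mul_cancel_left₀ hpos.ne'] at h1
  have h2 := hM (x + u) (by
    rw [mem_closedBall_iff_norm, add_sub_right_comm]
    exact (norm_add_le _ _).trans (by rw [hun]; linarith))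
  have h3 := hM x (by rw [mem_closedBall_iff_norm]; linarith)
  rw [Real.norm_eq_abs] at h2 h3
  have h4 := (abs_le.1 h2).2
  have h5 := (abs_le.1 h3).1
  linarith

/-- A convex function whose set of critical points is nonempty and bounded has bounded sublevel
sets. -/
theorem exists_sublevel_bound [FiniteDimensional ℝ E] {g : E → ℝ} (hd : Differentiable ℝ g)
    (hc : ConvexOn ℝ Set.univ g) (hne : {x | gradient g x = 0}.Nonempty)
    (hb : Bornology.IsBounded {x | gradient g x = 0}) (z : E) (c : ℝ) :
    ∃ R, ∀ x, g x ≤ c → ‖x - z‖ ≤ R := by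
  obtain ⟨p, hp⟩ := hne
  have hmin : ∀ x, g p ≤ g x := fun x => by
    have := inner_gradient_le hd hc p x
    rw [show gradient g p = 0 from hp, inner_zero_left] at this
    linarith
  obtain ⟨r, hr⟩ := hb.subset_closedBall p
  -- A sphere around the minimizer p that encloses all critical points, so g exceeds its minimum
  -- strictly on it.
  set ρ := max r 0 + 1 with hρ
  have hρ0 : 0 < ρ := by have := le_max_right r 0; linarith
  have hstrict : ∀ x, ‖x - p‖ = ρ → g p < g x := by
    intro x hx
    refine lt_of_le_of_ne (hmin x) fun heq => ?_
    have hloc : IsLocalMin g x := Filter.Eventually.of_forall fun y => heq ▸ hmin y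
    have h0 : gradient g x = 0 := by
      rw [gradient, hloc.fderiv_eq_zero, map_zero]
    have := hr (show x ∈ {x | gradient g x = 0} from h0)
    rw [mem_closedBall_iff_norm] at this
    have := le_max_left r 0
    linarith
  -- The sphere is empty only when the space is a single point.
  rcases (Metric.sphere p ρ).eq_empty_or_nonempty with hemp | hsne
  · refine ⟨ρ + ‖p - z‖, fun x _ => ?_⟩
    have hxp : ‖x - p‖ = 0 := by
      by_contra h
      have : p + (ρ / ‖x - p‖) • (x - p) ∈ Metric.sphere p ρ := by
        rw [mem_sphere_iff_norm, add_sub_cancel_left, norm_smul, Real.norm_of_nonneg (by positivity),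
          div_mul_cancel₀ _ h]
      rw [hemp] at this
      exact this
    calc ‖x - z‖ = ‖(x - p) + (p - z)‖ := by abel_nf
      _ ≤ ‖x - p‖ + ‖p - z‖ := norm_add_le _ _
      _ ≤ _ := by linarith
  obtain ⟨q, hq, hqmin⟩ := (isCompact_sphere p ρ).exists_isMinOn hsne hd.continuous.continuousOn
  set μ := g q - g p with hμ
  have hμ0 : 0 < μ := sub_pos.2 (hstrict q (by simpa [mem_sphere_iff_norm] using hq))
  -- By convexity on the segment from p to x, which crosses the sphere, g grows at least linearly
  -- outside it.
  have hgrow : ∀ x, ρ ≤ ‖x - p‖ → μ * ‖x - p‖ ≤ ρ * (g x - g p) := by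
    intro x hx
    have hx0 : 0 < ‖x - p‖ := hρ0.trans_le hx
    set t := ρ / ‖x - p‖ with ht
    have ht0 : 0 ≤ t := by positivity
    have ht1 : t ≤ 1 := (div_le_one hx0).2 hx
    have h1 := hc.2 (Set.mem_univ p) (Set.mem_univ x) (sub_nonneg.2 ht1) ht0 (by ring)
    have h2 : g q ≤ g ((1 - t) • p + t • x) := by
      refine hqmin ?_
      rw [mem_sphere_iff_norm]
      have : (1 - t) • p + t • x - p = t • (x - p) := by module
      rw [this, norm_smul, Real.norm_of_nonneg ht0, ht, div_mul_cancel₀ _ hx0.ne']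
    simp only [smul_eq_mul] at h1
    have h3 : μ ≤ t * (g x - g p) := by rw [hμ]; linarith
    calc μ * ‖x - p‖ ≤ t * (g x - g p) * ‖x - p‖ := mul_le_mul_of_nonneg_right h3 hx0.le
      _ = ρ * (g x - g p) := by rw [ht]; field_simp
  refine ⟨ρ + ρ * |c - g p| / μ + ‖p - z‖, fun x hx => ?_⟩
  have hxp : ‖x - p‖ ≤ ρ + ρ * |c - g p| / μ := by
    rcases le_total ‖x - p‖ ρ with h | h
    · have : 0 ≤ ρ * |c - g p| / μ := by positivity
      linarith
    · have h1 := hgrow x h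
      have h2 : ρ * (g x - g p) ≤ ρ * |c - g p| :=
        mul_le_mul_of_nonneg_left (le_trans (by linarith) (le_abs_self _)) hρ0.le
      have : ‖x - p‖ ≤ ρ * |c - g p| / μ := by
        rw [le_div_iff₀ hμ0]; linarith
      linarith
  calc ‖x - z‖ = ‖(x - p) + (p - z)‖ := by abel_nf
    _ ≤ ‖x - p‖ + ‖p - z‖ := norm_add_le _ _
    _ ≤ _ := by linarith

/-- A sum of finitely many coercive convex functions attains its minimum. -/
theorem exists_minimizer {n s : ℕ} (hn : 0 < n) {f : Fin n → Vec s → ℝ}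
    (hd : ∀ i, Differentiable ℝ (f i)) (hc : ∀ i, ConvexOn ℝ Set.univ (f i))
    (hX : ∀ i, (gradZeros (f i)).Nonempty ∧ Bornology.IsBounded (gradZeros (f i))) :
    (optimalSet f).Nonempty := by
  have hcont : Continuous (teamObjective f) :=
    continuous_finsetSum _ fun i _ => (hd i).continuous
  choose p hp using fun i => (hX i).1
  have hmin : ∀ i x, f i (p i) ≤ f i x := fun i x => by
    have := inner_gradient_le (hd i) (hc i) (p i) x
    rw [show gradient (f i) (p i) = 0 from hp i, inner_zero_left] at this
    linarith
  set i₀ : Fin n := ⟨0, hn⟩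
  -- As every other fᵢ is at least its minimum, a sublevel set of the sum lies in one of a single
  -- coercive term.
  obtain ⟨R, hR⟩ := exists_sublevel_bound (hd i₀) (hc i₀) (hX i₀).1 (hX i₀).2 (0 : Vec s)
    (teamObjective f 0 - (∑ i, f i (p i) - f i₀ (p i₀)))
  have hsub : ∀ x, teamObjective f x ≤ teamObjective f 0 → ‖x‖ ≤ R := by
    intro x hx
    rw [← sub_zero x]
    refine hR x ?_
    have h1 : ∑ i, (f i x - f i (p i)) ≥ f i₀ x - f i₀ (p i₀) :=
      Finset.single_le_sum (f := fun i => f i x - f i (p i))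
        (fun i _ => sub_nonneg.2 (hmin i x)) (Finset.mem_univ i₀)
    rw [Finset.sum_sub_distrib] at h1
    have h2 : teamObjective f x = ∑ i, f i x := rfl
    linarith
  obtain ⟨x, -, hx⟩ := (isCompact_closedBall (0 : Vec s) R).exists_isMinOn
    ⟨0, by simpa using hsub 0 le_rfl⟩ hcont.continuousOn
  refine ⟨x, fun y => ?_⟩
  by_cases hy : teamObjective f y ≤ teamObjective f 0
  · exact hx (by simpa using hsub y hy)
  · exact (hx (by simpa using hsub 0 le_rfl)).trans (not_le.1 hy).le

end Convex

/-! ### Two lemmas on real recursions. -/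

section Sequences

theorem tendsto_zero_of_contraction {a b : ℕ → ℝ} {l : ℝ} (hl0 : 0 ≤ l) (hl1 : l < 1)
    (ha : ∀ k, 0 ≤ a k) (hb : Tendsto b atTop (𝓝 0)) (h : ∀ k, a (k + 1) ≤ l * a k + b k) :
    Tendsto a atTop (𝓝 0) := by
  rw [Metric.tendsto_atTop]
  intro e he
  have hl : 0 < 1 - l := by linarith
  -- With perturbation (1 - l)(e/2), the level e/2 is a fixed point of the recursion.
  obtain ⟨M, hM⟩ := eventually_atTop.1 (hb.eventually (gt_mem_nhds (show 0 < (1 - l) * (e / 2) by positivity)))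
  have key : ∀ j, a (M + j) ≤ l ^ j * a M + e / 2 := by
    intro j
    induction j with
    | zero => simp; positivity
    | succ j ih =>
      have h1 := h (M + j)
      have h2 := hM (M + j) (by omega)
      have h3 := mul_le_mul_of_nonneg_left ih hl0
      rw [← add_assoc, pow_succ]
      nlinarith
  have hp : Tendsto (fun j => l ^ j * a M) atTop (𝓝 0) := by
    simpa using (tendsto_pow_atTop_nhds_zero_of_lt_one hl0 hl1).mul_const (a M)
  obtain ⟨J, hJ⟩ := eventually_atTop.1 (hp.eventually (gt_mem_nhds (half_pos he)))
  refine ⟨M + J, fun k hk => ?_⟩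
  obtain ⟨j, rfl⟩ := Nat.exists_eq_add_of_le (show M ≤ k by omega)
  have h1 := key j
  have h2 := hJ j (by omega)
  rw [Real.dist_eq, sub_zero, abs_of_nonneg (ha _)]
  linarith

/-- A nonnegative sequence whose increments are at most `b k - u k`, with `u` nonnegative and `b`
summable, converges, and `u` is summable. -/
theorem exists_tendsto_of_le_sub_add {W u b : ℕ → ℝ} (hW : ∀ k, 0 ≤ W k) (hu : ∀ k, 0 ≤ u k)
    (hb0 : ∀ k, 0 ≤ b k) (hb : Summable b) (h : ∀ k, W (k + 1) ≤ W k - u k + b k) :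
    (∃ L, Tendsto W atTop (𝓝 L)) ∧ Summable u := by
  set S : ℕ → ℝ := fun k => ∑ j ∈ Finset.range k, b j with hS
  have hSle : ∀ k, S k ≤ ∑' j, b j := fun k => hb.sum_le_tsum _ fun j _ => hb0 j
  constructor
  · have hanti : Antitone fun k => W k - S k := by
      refine antitone_nat_of_succ_le fun k => ?_
      have := h k
      have := hu k
      simp only [hS, Finset.sum_range_succ]
      linarith
    have hbdd : BddBelow (Set.range fun k => W k - S k) := by
      refine ⟨-∑' j, b j, ?_⟩
      rintro _ ⟨k, rfl⟩
      have := hW k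
      have := hSle k
      simp only
      linarith
    have h1 := (tendsto_atTop_ciInf hanti hbdd).add hb.hasSum.tendsto_sum_nat
    exact ⟨_, by simpa [hS] using h1⟩
  · have hsum : ∀ k, W k + ∑ j ∈ Finset.range k, u j ≤ W 0 + S k := by
      intro k
      induction k with
      | zero => simp [hS]
      | succ k ih =>
        have := h k
        simp only [hS, Finset.sum_range_succ] at ih ⊢
        linarith
    refine summable_of_sum_range_le (c := W 0 + ∑' j, b j) hu fun k => ?_
    have := hsum k
    have := hW k
    have := hSle k
    linarith

end Sequences

/-! ### Convergence of truncated gradient descent with contracting disagreement. -/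

section Lyapunov

open scoped RealInnerProductSpace

/-- The weight 2/(1 - l) makes the contraction of N release 2N². One N² absorbs the error of taking
gradients at wᵢ instead of X; the other stays in the bound for later use. -/
theorem lyapunov_step {E : Type*} [NormedAddCommGroup E] [InnerProductSpace ℝ E] {n : ℕ}
    {c a l C N N' : ℝ} {X X' z : E} {d w : Fin n → E} (hc : 0 ≤ c) (ha : 0 ≤ a) (hl0 : 0 ≤ l)
    (hl1 : l < 1) (hN' : 0 ≤ N')
    (hX : X' = X - (c * a) • ∑ i, d i) (hN : N' ≤ l * N + C * (a * ∑ i, ‖d i‖))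
    (hw : ∀ i, ‖w i - X‖ ≤ C * N) :
    ‖X' - z‖ ^ 2 + 2 / (1 - l) * N' ^ 2 ≤ ‖X - z‖ ^ 2 + 2 / (1 - l) * N ^ 2 - N ^ 2
      - 2 * c * a * ∑ i, ⟪d i, w i - z⟫
      + n * (c ^ 2 + c ^ 2 * C ^ 2 + 2 * C ^ 2 / (1 - l) ^ 2) * a ^ 2 * ∑ i, ‖d i‖ ^ 2 := by
  set D := ∑ i, ‖d i‖ with hD
  set S := ∑ i, ‖d i‖ ^ 2 with hS
  have hD0 : 0 ≤ D := Finset.sum_nonneg fun i _ => norm_nonneg _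
  have hDS : D ^ 2 ≤ n * S := by
    simpa using sq_sum_le_card_mul_sum_sq (s := Finset.univ) (f := fun i => ‖d i‖)
  have hq : 0 < 1 - l := by linarith
  have h1 : ‖X' - z‖ ^ 2 ≤ ‖X - z‖ ^ 2 - 2 * c * a * ∑ i, ⟪d i, X - z⟫ + c ^ 2 * a ^ 2 * D ^ 2 := by
    have e : X' - z = (X - z) - (c * a) • ∑ i, d i := by rw [hX]; abel
    rw [e, norm_sub_sq_real, real_inner_smul_right, real_inner_comm, sum_inner, norm_smul,
      Real.norm_of_nonneg (mul_nonneg hc ha), mul_pow]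
    have h2 : ‖∑ i, d i‖ ^ 2 ≤ D ^ 2 := pow_le_pow_left₀ (norm_nonneg _) (norm_sum_le _ _) 2
    have h3 := mul_le_mul_of_nonneg_left h2 (sq_nonneg (c * a))
    linarith
  have h2 : ∑ i, ⟪d i, w i - z⟫ ≤ ∑ i, ⟪d i, X - z⟫ + D * (C * N) := by
    rw [hD, Finset.sum_mul, ← Finset.sum_add_distrib]
    refine Finset.sum_le_sum fun i _ => ?_
    have e : w i - z = (X - z) + (w i - X) := by abel
    rw [e, inner_add_right]
    have h3 := (real_inner_le_norm (d i) (w i - X)).trans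
      (mul_le_mul_of_nonneg_left (hw i) (norm_nonneg _))
    linarith
  have h3 : 2 / (1 - l) * N' ^ 2
      ≤ 2 / (1 - l) * N ^ 2 - 2 * N ^ 2 + 2 * C ^ 2 / (1 - l) ^ 2 * (a ^ 2 * D ^ 2) := by
    have h4 : N' ^ 2 ≤ (l * N + C * (a * D)) ^ 2 := pow_le_pow_left₀ hN' hN 2
    -- Convexity of the square, with weights l and 1 - l.
    have h5 : (l * N + C * (a * D)) ^ 2 ≤ l * N ^ 2 + (C * (a * D)) ^ 2 / (1 - l) := by
      have e : l * N ^ 2 + (C * (a * D)) ^ 2 / (1 - l) - (l * N + C * (a * D)) ^ 2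
          = l / (1 - l) * ((1 - l) * N - C * (a * D)) ^ 2 := by
        field_simp
        ring
      have : 0 ≤ l / (1 - l) * ((1 - l) * N - C * (a * D)) ^ 2 :=
        mul_nonneg (div_nonneg hl0 hq.le) (sq_nonneg _)
      linarith
    calc _ ≤ 2 / (1 - l) * (l * N ^ 2 + (C * (a * D)) ^ 2 / (1 - l)) :=
          mul_le_mul_of_nonneg_left (h4.trans h5) (by positivity)
      _ = _ := by field_simp; ring
  have h4 : 2 * c * a * (D * (C * N)) ≤ N ^ 2 + c ^ 2 * C ^ 2 * (a ^ 2 * D ^ 2) := by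
    nlinarith [sq_nonneg (N - c * C * (a * D))]
  have h5 : (c ^ 2 + c ^ 2 * C ^ 2 + 2 * C ^ 2 / (1 - l) ^ 2) * a ^ 2 * D ^ 2
      ≤ (c ^ 2 + c ^ 2 * C ^ 2 + 2 * C ^ 2 / (1 - l) ^ 2) * a ^ 2 * (n * S) :=
    mul_le_mul_of_nonneg_left hDS (by positivity)
  have h6 := mul_le_mul_of_nonneg_left h2 (by positivity : 0 ≤ 2 * c * a)
  linarith

theorem truncGrad_of_lt {s : ℕ} {a : ℝ} {g : Vec s → ℝ} {w : Vec s}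
    (h : 1 / √a < ‖gradient g w‖ ^ 2) : truncGrad a g w = 0 := if_pos h

theorem truncGrad_of_le {s : ℕ} {a : ℝ} {g : Vec s → ℝ} {w : Vec s}
    (h : ‖gradient g w‖ ^ 2 ≤ 1 / √a) : truncGrad a g w = gradient g w := if_neg (not_lt.2 h)

/-- This stands in for a gradient bound: the second-order term α²‖d‖² is at most α√α, negligible
against a first-order decrease of order α. -/
theorem mul_norm_truncGrad_sq_le {s : ℕ} {a : ℝ} (ha : 0 < a) (g : Vec s → ℝ) (w : Vec s) :
    a * ‖truncGrad a g w‖ ^ 2 ≤ √a := by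
  unfold truncGrad
  split_ifs with h
  · simp
  · calc a * ‖gradient g w‖ ^ 2 ≤ a * (1 / √a) := mul_le_mul_of_nonneg_left (not_lt.1 h) ha.le
      _ = √a := by rw [mul_one_div, Real.div_sqrt]

/-- The contribution of one agent to the increment of the Lyapunov function is nonpositive unless
the agent is in a bounded region, where it is at most a constant. -/
theorem truncGrad_descent {s : ℕ} {g : Vec s → ℝ} (hd : Differentiable ℝ g)
    (hc : ConvexOn ℝ Set.univ g) {z : Vec s} {R G c Q a : ℝ}
    (hR : ∀ x, g x ≤ g z + 1 → ‖x - z‖ ≤ R) (hG : ∀ x, ‖x - z‖ ≤ R → ‖gradient g x‖ ≤ G)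
    (hc0 : 0 ≤ c) (hQ0 : 0 ≤ Q) (ha : 0 < a) (haQ : Q * √a ≤ 2 * c) (w : Vec s) :
    -(2 * c * ⟪truncGrad a g w, w - z⟫) + Q * (a * ‖truncGrad a g w‖ ^ 2) ≤ 0 ∨
      (‖w - z‖ ≤ R ∧
        -(2 * c * ⟪truncGrad a g w, w - z⟫) + Q * (a * ‖truncGrad a g w‖ ^ 2)
          ≤ 2 * c * (G * R + 1)) := by
  have hQ := (mul_le_mul_of_nonneg_left (mul_norm_truncGrad_sq_le ha g w) hQ0).trans haQ
  rcases lt_or_ge (1 / √a) (‖gradient g w‖ ^ 2) with h | h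
  · left
    simp [truncGrad_of_lt h]
  · have e : truncGrad a g w = gradient g w := truncGrad_of_le h
    rw [e] at hQ ⊢
    have h1 := inner_gradient_le hd hc w z
    have h1' : g w - g z ≤ ⟪gradient g w, w - z⟫ := by
      rw [← neg_sub w z, inner_neg_right] at h1
      linarith
    -- Above the level g z + 1, convexity makes the inner product at least 1, and the decrease 2c
    -- outweighs the quadratic term. Below it, w lies in a bounded sublevel set.
    rcases le_or_gt (g w) (g z + 1) with h2 | h2
    · right
      have h3 := hR w h2
      refine ⟨h3, ?_⟩
      have h4 := neg_le_of_abs_le (abs_real_inner_le_norm (gradient g w) (w - z))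
      have h5 : ‖gradient g w‖ * ‖w - z‖ ≤ G * R :=
        mul_le_mul (hG w h3) h3 (norm_nonneg _) ((norm_nonneg _).trans (hG w h3))
      have h6 : -⟪gradient g w, w - z⟫ ≤ G * R := by linarith
      have h7 := mul_le_mul_of_nonneg_left h6 (by linarith : 0 ≤ 2 * c)
      linarith
    · left
      have h7 := mul_le_mul_of_nonneg_left (by linarith : 1 ≤ ⟪gradient g w, w - z⟫)
        (by linarith : 0 ≤ 2 * c)
      linarith

/-- A truncated gradient iteration driven by the points `w`, which stay within a contracting
disagreement `N` of the running average `X`. -/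
structure IsPerturbedDescent {n s : ℕ} (c l C : ℝ) (α : ℕ → ℝ) (f : Fin n → Vec s → ℝ)
    (X : ℕ → Vec s) (N : ℕ → ℝ) (w : ℕ → Fin n → Vec s) : Prop where
  average : ∀ k, X (k + 1) = X k - (c * α k) • ∑ i, truncGrad (α k) (f i) (w k i)
  nonneg : ∀ k, 0 ≤ N k
  disagreement : ∀ k, N (k + 1) ≤ l * N k + C * (α k * ∑ i, ‖truncGrad (α k) (f i) (w k i)‖)
  close : ∀ k i, ‖w k i - X k‖ ≤ C * N k

variable {n s : ℕ} {c l C : ℝ} {α : ℕ → ℝ} {f : Fin n → Vec s → ℝ}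
  {X : ℕ → Vec s} {N : ℕ → ℝ} {w : ℕ → Fin n → Vec s}

theorem IsPerturbedDescent.tendsto_disagreement (h : IsPerturbedDescent c l C α f X N w)
    (hl0 : 0 ≤ l) (hl1 : l < 1) (hα : ∀ k, 0 < α k) (hα0 : Tendsto α atTop (𝓝 0)) :
    Tendsto N atTop (𝓝 0) := by
  refine tendsto_zero_of_contraction hl0 hl1 h.nonneg ?_ h.disagreement
  have hi : ∀ i, Tendsto (fun k => α k * ‖truncGrad (α k) (f i) (w k i)‖) atTop (𝓝 0) := by
    intro i
    have hs : Tendsto (fun k => √(α k * √(α k))) atTop (𝓝 0) := by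
      have h1 : Tendsto (fun k => √(α k)) atTop (𝓝 0) := by
        simpa using hα0.sqrt
      simpa using (hα0.mul h1).sqrt
    refine squeeze_zero (fun k => mul_nonneg (hα k).le (norm_nonneg _)) (fun k => ?_) hs
    refine Real.le_sqrt_of_sq_le ?_
    have := mul_le_mul_of_nonneg_left (mul_norm_truncGrad_sq_le (hα k) (f i) (w k i)) (hα k).le
    calc _ = α k * (α k * ‖truncGrad (α k) (f i) (w k i)‖ ^ 2) := by ring
      _ ≤ _ := this
  have := (tendsto_finsetSum Finset.univ fun i _ => hi i).const_mul C
  simpa [Finset.mul_sum] using this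

/-- Measured from 0, which need not be a minimizer, the Lyapunov function eventually cannot rise
unless some agent is in its bounded region. Then X is near that agent since N < 1, so the new value
is below a fixed `W₁`. Hence it never exceeds the larger of `W₁` and its value at `k₀`. -/
theorem IsPerturbedDescent.exists_bound (h : IsPerturbedDescent c l C α f X N w)
    (hc : 0 < c) (hl0 : 0 ≤ l) (hl1 : l < 1) (hC : 0 ≤ C)
    (hd : ∀ i, Differentiable ℝ (f i)) (hcv : ∀ i, ConvexOn ℝ Set.univ (f i))
    (hX : ∀ i, (gradZeros (f i)).Nonempty ∧ Bornology.IsBounded (gradZeros (f i)))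
    (hα : ∀ k, 0 < α k) (hα0 : Tendsto α atTop (𝓝 0)) :
    ∃ R, ∀ᶠ k in atTop, ‖X k‖ ≤ R := by
  have hN0 := h.tendsto_disagreement hl0 hl1 hα hα0
  choose R hR using fun i => exists_sublevel_bound (hd i) (hcv i) (hX i).1 (hX i).2 0 (f i 0 + 1)
  choose G hG using fun i => exists_gradient_bound (hd i) (hcv i) 0 (R i)
  set Q : ℝ := n * (c ^ 2 + c ^ 2 * C ^ 2 + 2 * C ^ 2 / (1 - l) ^ 2) with hQ
  have hQ0 : 0 ≤ Q := by positivity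
  have hq : 0 < 1 - l := by linarith
  have hsqrt : Tendsto (fun k => Q * √(α k)) atTop (𝓝 0) := by
    simpa using hα0.sqrt.const_mul Q
  obtain ⟨k₀, hk₀⟩ := eventually_atTop.1 ((hα0.eventually (gt_mem_nhds one_pos)).and
    ((hN0.eventually (gt_mem_nhds one_pos)).and
      (hsqrt.eventually (gt_mem_nhds (show 0 < 2 * c by linarith)))))
  set W : ℕ → ℝ := fun k => ‖X k - 0‖ ^ 2 + 2 / (1 - l) * N k ^ 2 with hW
  set K : ℝ := ∑ i, |2 * c * (G i * R i + 1)| with hK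
  set R' : ℝ := ∑ i, |R i| with hR'
  set W₁ : ℝ := (R' + C) ^ 2 + 2 / (1 - l) + K with hW₁
  have hK0 : 0 ≤ K := Finset.sum_nonneg fun _ _ => abs_nonneg _
  have hstep : ∀ k, k₀ ≤ k → W (k + 1) ≤ max (W k) W₁ := by
    intro k hk
    obtain ⟨ha1, hN1, hsq⟩ := hk₀ k hk
    have hN0k := h.nonneg k
    set d : Fin n → Vec s := fun i => truncGrad (α k) (f i) (w k i) with hdk
    have hlyap : W (k + 1) ≤ W k + α k * ∑ i, (-(2 * c * ⟪d i, w k i - 0⟫)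
        + Q * (α k * ‖d i‖ ^ 2)) := by
      have := lyapunov_step (z := 0) (d := d) hc.le (hα k).le hl0 hl1 (h.nonneg (k + 1))
        (h.average k) (h.disagreement k) (h.close k)
      rw [Finset.sum_add_distrib, Finset.sum_neg_distrib, ← Finset.mul_sum, ← Finset.mul_sum,
        ← Finset.mul_sum]
      have := sq_nonneg (N k)
      simp only [hW, hQ]
      linarith
    have hdesc := fun i => truncGrad_descent (hd i) (hcv i) (hR i) (hG i) hc.le hQ0 (hα k)
      hsq.le (w k i)
    by_cases hfar : ∀ i, -(2 * c * ⟪d i, w k i - 0⟫) + Q * (α k * ‖d i‖ ^ 2) ≤ 0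
    · refine le_max_of_le_left (hlyap.trans ?_)
      have h1 : ∑ i, (-(2 * c * ⟪d i, w k i - 0⟫) + Q * (α k * ‖d i‖ ^ 2)) ≤ 0 :=
        Finset.sum_nonpos fun i _ => hfar i
      have := mul_nonpos_of_nonneg_of_nonpos (hα k).le h1
      linarith
    · refine le_max_of_le_right (hlyap.trans ?_)
      push Not at hfar
      obtain ⟨j, hj⟩ := hfar
      have hwj : ‖w k j - 0‖ ≤ R j := by
        rcases hdesc j with h1 | h1
        · exact absurd h1 (not_le.2 hj)
        · exact h1.1
      have hsum : ∑ i, (-(2 * c * ⟪d i, w k i - 0⟫) + Q * (α k * ‖d i‖ ^ 2)) ≤ K := by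
        refine Finset.sum_le_sum fun i _ => ?_
        rcases hdesc i with h1 | h1
        · exact h1.trans (abs_nonneg _)
        · exact h1.2.trans (le_abs_self _)
      have h1 : α k * ∑ i, (-(2 * c * ⟪d i, w k i - 0⟫) + Q * (α k * ‖d i‖ ^ 2)) ≤ K :=
        (mul_le_mul_of_nonneg_left hsum (hα k).le).trans
          (mul_le_of_le_one_left hK0 ha1.le)
      have hRj : R j ≤ R' := (le_abs_self _).trans
        (Finset.single_le_sum (f := fun i => |R i|) (fun _ _ => abs_nonneg _) (Finset.mem_univ j))
      have hXk : ‖X k - 0‖ ≤ R' + C := by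
        have e : X k - 0 = (w k j - 0) - (w k j - X k) := by abel
        rw [e]
        refine (norm_sub_le _ _).trans (add_le_add (hwj.trans hRj) ((h.close k j).trans ?_))
        exact mul_le_of_le_one_right hC hN1.le
      have h2 : ‖X k - 0‖ ^ 2 ≤ (R' + C) ^ 2 := pow_le_pow_left₀ (norm_nonneg _) hXk 2
      have h3 : 2 / (1 - l) * N k ^ 2 ≤ 2 / (1 - l) :=
        mul_le_of_le_one_right (by positivity) (pow_le_one₀ hN0k hN1.le)
      simp only [hW, hW₁]
      linarith
  have hbound : ∀ k, k₀ ≤ k → W k ≤ max (W k₀) W₁ := by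
    intro k hk
    induction k, hk using Nat.le_induction with
    | base => exact le_max_left _ _
    | succ k hk ih => exact (hstep k hk).trans (max_le ih (le_max_right _ _))
  refine ⟨√(max (W k₀) W₁), eventually_atTop.2 ⟨k₀, fun k hk => Real.le_sqrt_of_sq_le ?_⟩⟩
  have h1 := hbound k hk
  have h2 : 0 ≤ 2 / (1 - l) * N k ^ 2 := by positivity
  simp only [hW, sub_zero] at h1 ⊢
  linarith

/-- Bounded X bounds the points wᵢ and their gradients, while the threshold 1/√α tends to infinity,
so truncation eventually never acts. The constant and the starting time are uniform in z, so z may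
be chosen afterwards as a limit point of X. -/
theorem IsPerturbedDescent.eventually_step (h : IsPerturbedDescent c l C α f X N w)
    (hc : 0 < c) (hl0 : 0 ≤ l) (hl1 : l < 1) (hC : 0 ≤ C)
    (hd : ∀ i, Differentiable ℝ (f i)) (hcv : ∀ i, ConvexOn ℝ Set.univ (f i))
    (hα : ∀ k, 0 < α k) (hα0 : Tendsto α atTop (𝓝 0)) {R : ℝ}
    (hR : ∀ᶠ k in atTop, ‖X k‖ ≤ R) :
    ∃ M : ℝ, 0 ≤ M ∧ ∀ᶠ k in atTop, ∀ z : Vec s,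
      ‖X (k + 1) - z‖ ^ 2 + 2 / (1 - l) * N (k + 1) ^ 2 ≤ ‖X k - z‖ ^ 2 + 2 / (1 - l) * N k ^ 2
        - 2 * c * α k * (teamObjective f (X k) - teamObjective f z) + M * α k ^ 2 := by
  have hN0 := h.tendsto_disagreement hl0 hl1 hα hα0
  choose G hG using fun i => exists_gradient_bound (hd i) (hcv i) 0 (R + C)
  set Q : ℝ := n * (c ^ 2 + c ^ 2 * C ^ 2 + 2 * C ^ 2 / (1 - l) ^ 2) with hQ
  have hQ0 : 0 ≤ Q := by positivity
  set G' : ℝ := ∑ i, |G i| with hG'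
  have hG'0 : 0 ≤ G' := Finset.sum_nonneg fun _ _ => abs_nonneg _
  set G₂ : ℝ := ∑ i, G i ^ 2 with hG₂
  have hG₂0 : 0 ≤ G₂ := Finset.sum_nonneg fun _ _ => sq_nonneg _
  refine ⟨c ^ 2 * G' ^ 2 * C ^ 2 + Q * G₂, by positivity, ?_⟩
  have htrunc : ∀ᶠ k in atTop, G₂ * √(α k) < 1 := by
    have : Tendsto (fun k => G₂ * √(α k)) atTop (𝓝 0) := by
      simpa using hα0.sqrt.const_mul G₂
    exact this.eventually (gt_mem_nhds one_pos)
  filter_upwards [hR, hN0.eventually (gt_mem_nhds one_pos), htrunc] with k hRk hN1 hGk z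
  have hNk := h.nonneg k
  have hXR : ‖X k - 0‖ ≤ R + C := by rw [sub_zero]; linarith
  have hwR : ∀ i, ‖w k i - 0‖ ≤ R + C := by
    intro i
    have e : w k i - 0 = X k + (w k i - X k) := by abel
    rw [e]
    exact (norm_add_le _ _).trans (add_le_add hRk ((h.close k i).trans
      (mul_le_of_le_one_right hC hN1.le)))
  have hGsq : ∀ i, ‖gradient (f i) (w k i)‖ ^ 2 ≤ G i ^ 2 := fun i =>
    pow_le_pow_left₀ (norm_nonneg _) (hG i _ (hwR i)) 2
  have hds : ∀ i, truncGrad (α k) (f i) (w k i) = gradient (f i) (w k i) := by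
    intro i
    have h1 : ‖gradient (f i) (w k i)‖ ^ 2 ≤ 1 / √(α k) := by
      rw [le_div_iff₀ (Real.sqrt_pos.2 (hα k))]
      refine le_trans (mul_le_mul_of_nonneg_right ((hGsq i).trans ?_) (Real.sqrt_nonneg _)) hGk.le
      exact Finset.single_le_sum (f := fun i => G i ^ 2) (fun _ _ => sq_nonneg _)
        (Finset.mem_univ i)
    exact truncGrad_of_le h1
  have h1 := lyapunov_step (z := z) hc.le (hα k).le hl0 hl1 (h.nonneg (k + 1))
    (h.average k) (h.disagreement k) (h.close k)
  simp only [hds] at h1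
  have h2 : teamObjective f (X k) - teamObjective f z - G' * (C * N k)
      ≤ ∑ i, ⟪gradient (f i) (w k i), w k i - z⟫ := by
    simp only [teamObjective, hG', Finset.sum_mul]
    rw [← Finset.sum_sub_distrib, ← Finset.sum_sub_distrib]
    refine Finset.sum_le_sum fun i _ => ?_
    have g1 := inner_gradient_le (hd i) (hcv i) (w k i) z
    rw [← neg_sub (w k i) z, inner_neg_right] at g1
    have g2 := inner_gradient_le (hd i) (hcv i) (X k) (w k i)
    have g3 := neg_le_of_abs_le (abs_real_inner_le_norm (gradient (f i) (X k)) (w k i - X k))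
    have g4 : ‖gradient (f i) (X k)‖ * ‖w k i - X k‖ ≤ |G i| * (C * N k) :=
      mul_le_mul ((hG i _ hXR).trans (le_abs_self _)) (h.close k i) (norm_nonneg _)
        (abs_nonneg _)
    linarith
  have h3 : ∑ i, ‖gradient (f i) (w k i)‖ ^ 2 ≤ G₂ := Finset.sum_le_sum fun i _ => hGsq i
  have hαk := hα k
  have h4 := mul_le_mul_of_nonneg_left h2 (by positivity : 0 ≤ 2 * c * α k)
  have h5 := mul_le_mul_of_nonneg_left h3 (by positivity : 0 ≤ Q * α k ^ 2)
  -- The N² left over in `lyapunov_step` pays for comparing f at wᵢ with f at X.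
  have h6 : 2 * c * α k * (G' * (C * N k))
      ≤ N k ^ 2 + c ^ 2 * G' ^ 2 * C ^ 2 * α k ^ 2 := by
    nlinarith [sq_nonneg (N k - c * G' * C * α k)]
  simp only [hQ] at h5 ⊢
  linarith

theorem IsPerturbedDescent.exists_tendsto (hn : 0 < n) (h : IsPerturbedDescent c l C α f X N w)
    (hc : 0 < c) (hl0 : 0 ≤ l) (hl1 : l < 1) (hC : 0 ≤ C)
    (hd : ∀ i, Differentiable ℝ (f i)) (hcv : ∀ i, ConvexOn ℝ Set.univ (f i))
    (hX : ∀ i, (gradZeros (f i)).Nonempty ∧ Bornology.IsBounded (gradZeros (f i)))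
    (hα : ∀ k, 0 < α k) (hα0 : Tendsto α atTop (𝓝 0))
    (hdiv : Tendsto (fun M => ∑ k ∈ Finset.range M, α k) atTop atTop)
    (hsq : Summable fun k => α k ^ 2) :
    ∃ x ∈ optimalSet f, Tendsto X atTop (𝓝 x) := by
  have hN0 := h.tendsto_disagreement hl0 hl1 hα hα0
  have hq : 0 < 1 - l := by linarith
  obtain ⟨R, hR⟩ := h.exists_bound hc hl0 hl1 hC hd hcv hX hα hα0
  obtain ⟨M, hM0, hM⟩ := h.eventually_step hc hl0 hl1 hC hd hcv hα hα0 hR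
  obtain ⟨k₀, hk₀⟩ := eventually_atTop.1 (hR.and hM)
  have hcont : Continuous (teamObjective f) :=
    continuous_finsetSum _ fun i _ => (hd i).continuous
  have key : ∀ z ∈ optimalSet f,
      (∃ L, Tendsto (fun k => ‖X (k + k₀) - z‖ ^ 2 + 2 / (1 - l) * N (k + k₀) ^ 2) atTop (𝓝 L)) ∧
      Summable fun k => 2 * c * α (k + k₀) *
        (teamObjective f (X (k + k₀)) - teamObjective f z) := by
    intro z hz
    refine exists_tendsto_of_le_sub_add (b := fun k => M * α (k + k₀) ^ 2)
      (fun k => by positivity) (fun k => ?_) (fun k => by positivity)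
      (((summable_nat_add_iff k₀).2 hsq).mul_left M) (fun k => ?_)
    · have := hα (k + k₀)
      exact mul_nonneg (by positivity) (sub_nonneg.2 (hz _))
    · have := (hk₀ (k + k₀) (by omega)).2 z
      rwa [add_right_comm] at this
  obtain ⟨z, hz⟩ := exists_minimizer hn hd hcv hX
  -- A gap eventually bounded below by η would make α summable, since α times the gap is.
  have hfreq : ∀ η : ℝ, 0 < η → ∀ m, ∃ k, m ≤ k ∧
      teamObjective f (X (k + k₀)) - teamObjective f z < η := by
    intro η hη m
    by_contra! hcon
    have hns : ¬ Summable α :=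
      (not_summable_iff_tendsto_nat_atTop_of_nonneg fun k => (hα k).le).2 hdiv
    apply hns
    rw [← summable_nat_add_iff (m + k₀)]
    have hs := ((summable_nat_add_iff m).2 (key z hz).2).mul_left (1 / (2 * c * η))
    refine Summable.of_nonneg_of_le (fun k => (hα _).le) (fun k => ?_) hs
    have h1 := hcon (k + m) (by omega)
    have h2 := hα (k + m + k₀)
    rw [← add_assoc k m k₀]
    calc α (k + m + k₀) = 1 / (2 * c * η) * (2 * c * α (k + m + k₀) * η) := by field_simp
      _ ≤ _ := by gcongr
  choose φ hφ hφlt using fun j : ℕ => hfreq (1 / ((j : ℝ) + 1)) (by positivity) j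
  obtain ⟨x, -, ψ, hψ, hlim⟩ := (isCompact_closedBall (0 : Vec s) R).tendsto_subseq
    (x := fun j => X (φ j + k₀)) fun j => by
      rw [mem_closedBall_zero_iff]
      exact (hk₀ _ (by omega)).1
  have hφψ : Tendsto (fun j => φ (ψ j)) atTop atTop :=
    (tendsto_atTop_mono hφ tendsto_id).comp hψ.tendsto_atTop
  have hxz : teamObjective f x ≤ teamObjective f z := by
    have h1 : Tendsto (fun j => teamObjective f (X (φ (ψ j) + k₀))) atTop
        (𝓝 (teamObjective f x)) := (hcont.tendsto x).comp hlim
    have h2 : Tendsto (fun j => teamObjective f z + 1 / ((ψ j : ℝ) + 1)) atTop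
        (𝓝 (teamObjective f z + 0)) :=
      (tendsto_one_div_add_atTop_nhds_zero_nat.comp hψ.tendsto_atTop).const_add _
    rw [add_zero] at h2
    exact le_of_tendsto_of_tendsto' h1 h2 fun j => by have := hφlt (ψ j); linarith
  have hx : x ∈ optimalSet f := fun y => hxz.trans (hz y)
  refine ⟨x, hx, ?_⟩
  obtain ⟨L, hL⟩ := (key x hx).1
  -- The Lyapunov function centred at the limit point x converges, and it tends to 0 along the
  -- subsequence.
  have hL0 : L = 0 := by
    refine tendsto_nhds_unique (hL.comp hφψ) ?_
    have h1 : Tendsto (fun j => ‖X (φ (ψ j) + k₀) - x‖ ^ 2) atTop (𝓝 0) := by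
      have : Tendsto (fun j => X (φ (ψ j) + k₀) - x) atTop (𝓝 (x - x)) := hlim.sub_const x
      simpa using this.norm.pow 2
    have h2 : Tendsto (fun j => 2 / (1 - l) * N (φ (ψ j) + k₀) ^ 2) atTop (𝓝 0) := by
      have : Tendsto (fun j => N (φ (ψ j) + k₀)) atTop (𝓝 0) :=
        hN0.comp ((tendsto_add_atTop_nat k₀).comp hφψ)
      simpa using (this.pow 2).const_mul (2 / (1 - l))
    have h3 := h1.add h2
    rw [add_zero] at h3
    exact h3
  rw [hL0] at hL
  have h1 : Tendsto (fun k => ‖X (k + k₀) - x‖ ^ 2) atTop (𝓝 0) :=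
    squeeze_zero (fun k => by positivity)
      (fun k => le_add_of_nonneg_right (by positivity)) hL
  have h2 : Tendsto (fun k => ‖X (k + k₀) - x‖) atTop (𝓝 0) := by
    simpa using h1.sqrt
  exact (tendsto_add_atTop_iff_nat k₀).1 (tendsto_iff_norm_sub_tendsto_zero.2 h2)

end Lyapunov

/-! ### From the second-order network to perturbed gradient descent. -/

section Reduction

variable {n s : ℕ} {A B : Matrix (Fin n) (Fin n) ℝ} {T ε : ℝ} {α : ℕ → ℝ}
  {f : Fin n → Vec s → ℝ} {r q y : ℕ → Fin n → Vec s}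

theorem mix_stepMatrix_add (A : Matrix (Fin n) (Fin n) ℝ) (T : ℝ) (r q : Fin n → Vec s)
    (i : Fin n) : mix (stepMatrix A T) (r + q) i = r i + q i + T • coupling A r q i := by
  rw [mix_stepMatrix, coupling]
  simp only [Pi.add_apply, add_sub_add_comm]

/-- The increment Tq of the position cancels the damping -Tq of the velocity, so r + q obeys a
first-order consensus iteration. -/
theorem IsTrajectory.sum_step (h : IsTrajectory A B T ε α f r q y) (k : ℕ) :
    r (k + 1) + q (k + 1) = mix (stepMatrix A T) (r k + q k) + (ε * T) • y k := by
  ext1 i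
  simp only [Pi.add_apply, Pi.smul_apply, mix_stepMatrix_add, h.position, h.velocity, control]
  module

theorem IsTrajectory.surplus_step (h : IsTrajectory A B T ε α f r q y) (k : ℕ) :
    y (k + 1) = (r k + q k) - mix (stepMatrix A T) (r k + q k) + mix B (y k) - (ε * T) • y k
      - (α k * T) • fun i => truncGrad (α k) (f i) (auxPoint B (r k) (q k) (y k) i) := by
  ext1 i
  simp only [Pi.add_apply, Pi.sub_apply, Pi.smul_apply, mix_stepMatrix_add, h.surplus,
    mix_apply B]
  module

/-- The average of `x + y` over the network. -/
def totalAverage (x y : Fin n → Vec s) : Vec s := (1 / (n : ℝ)) • (∑ i, x i + ∑ i, y i)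

theorem sum_sub_totalAverage (hn : 0 < n) (x y : Fin n → Vec s) :
    ∑ i, (x - fun _ => totalAverage x y : Fin n → Vec s) i + ∑ i, y i = 0 := by
  have hn' : (n : ℝ) ≠ 0 := by exact_mod_cast hn.ne'
  simp only [Pi.sub_apply, Finset.sum_sub_distrib, Finset.sum_const, Finset.card_univ,
    Fintype.card_fin, totalAverage]
  rw [← Nat.cast_smul_eq_nsmul ℝ, smul_smul, mul_one_div_cancel hn', one_smul]
  abel

/-- What x loses through P and gains from δy, the surplus records with the opposite sign, and B
preserves sums. Only the gradients move the total. -/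
theorem IsTrajectory.totalAverage_step (h : IsTrajectory A B T ε α f r q y)
    (hB : IsSurplusWeight A B) (k : ℕ) :
    totalAverage (r (k + 1) + q (k + 1)) (y (k + 1)) = totalAverage (r k + q k) (y k)
      - (T / n * α k) • ∑ i, truncGrad (α k) (f i) (auxPoint B (r k) (q k) (y k) i) := by
  unfold totalAverage
  rw [h.sum_step, h.surplus_step]
  simp only [Pi.add_apply, Pi.sub_apply, Pi.smul_apply, Finset.sum_add_distrib,
    Finset.sum_sub_distrib, sum_mix hB.col_sum, ← Finset.smul_sum]
  module

/-- P fixes constants, so subtracting the total average leaves the linear step intact and puts the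
state in the contracted subspace. Gradients perturb it twice, through the average and through y,
each with ℓ¹ size at most Tα∑‖d‖: hence K(2T). The other K bounds the distance of the auxiliary
points from the average. -/
theorem IsTrajectory.exists_perturbedDescent (hn : 0 < n) (hB : IsSurplusWeight A B)
    (hT : 0 < T) (hα : ∀ k, 0 < α k) (h : IsTrajectory A B T ε α f r q y) {l K : ℝ} (hK : 0 < K)
    {N : (Fin n → Vec s) → (Fin n → Vec s) → ℝ} (hN0 : ∀ x y, 0 ≤ N x y)
    (hNadd : ∀ x y x' y', N (x + x') (y + y') ≤ N x y + N x' y')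
    (hNstep : ∀ x y, ∑ i, x i + ∑ i, y i = 0 →
      N (mix (stepMatrix A T) x + (ε * T) • y)
        (x - mix (stepMatrix A T) x + mix B y - (ε * T) • y) ≤ l * N x y)
    (hNlow : ∀ x y, ∑ i, x i + ∑ i, y i = 0 → ∑ i, ‖x i‖ + ∑ i, ‖y i‖ ≤ K * N x y)
    (hNup : ∀ x y, N x y ≤ K * (∑ i, ‖x i‖ + ∑ i, ‖y i‖)) :
    IsPerturbedDescent (T / n) l (K + K * (2 * T)) α f
      (fun k => totalAverage (r k + q k) (y k))
      (fun k => N (r k + q k - fun _ => totalAverage (r k + q k) (y k)) (y k))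
      (fun k => auxPoint B (r k) (q k) (y k)) := by
  have hn' : (0 : ℝ) < n := by exact_mod_cast hn
  refine ⟨fun k => h.totalAverage_step hB k, fun k => hN0 _ _, fun k => ?_, fun k i => ?_⟩
  · set d : Fin n → Vec s :=
      fun i => truncGrad (α k) (f i) (auxPoint B (r k) (q k) (y k) i) with hd
    set X := totalAverage (r k + q k) (y k) with hX
    set x := r k + q k - fun _ => X with hx
    have hxs : r k + q k = x + fun _ => X := by rw [hx]; abel
    have hPc : mix (stepMatrix A T) (fun _ => X) = fun _ : Fin n => X := by
      ext1 i
      rw [mix_apply, ← Finset.sum_smul, stepMatrix_row_sum, one_smul]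
    have e1 : (r (k + 1) + q (k + 1) - fun _ => totalAverage (r (k + 1) + q (k + 1)) (y (k + 1)))
        = (mix (stepMatrix A T) x + (ε * T) • y k) + fun _ => (T / n * α k) • ∑ i, d i := by
      rw [h.totalAverage_step hB, h.sum_step, hxs, map_add, hPc]
      ext1 i
      simp only [Pi.add_apply, Pi.sub_apply]
      rw [← hxs, ← hX]
      abel
    have e2 : y (k + 1) = (x - mix (stepMatrix A T) x + mix B (y k) - (ε * T) • y k)
        + (-((α k * T) • d)) := by
      rw [h.surplus_step, hxs, map_add, hPc]
      abel
    have hD : ‖∑ i, d i‖ ≤ ∑ i, ‖d i‖ := norm_sum_le _ _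
    have hD0 : 0 ≤ ∑ i, ‖d i‖ := Finset.sum_nonneg fun i _ => norm_nonneg _
    have hαk := hα k
    have hup : N (fun _ => (T / n * α k) • ∑ i, d i) (-((α k * T) • d))
        ≤ K * (2 * T) * (α k * ∑ i, ‖d i‖) := by
      refine (hNup _ _).trans ?_
      rw [mul_assoc K]
      refine mul_le_mul_of_nonneg_left ?_ hK.le
      have g1 : ∑ _i : Fin n, ‖(T / n * α k) • ∑ i, d i‖ ≤ T * (α k * ∑ i, ‖d i‖) := by
        rw [Finset.sum_const, Finset.card_univ, Fintype.card_fin, nsmul_eq_mul, norm_smul,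
          Real.norm_of_nonneg (by positivity)]
        calc _ = T * (α k * ‖∑ i, d i‖) := by field_simp
          _ ≤ _ := by gcongr
      have g2 : ∑ i, ‖(-((α k * T) • d)) i‖ = T * (α k * ∑ i, ‖d i‖) := by
        simp only [Pi.neg_apply, Pi.smul_apply, norm_neg, norm_smul, ← Finset.mul_sum]
        rw [Real.norm_of_nonneg (by positivity)]
        ring
      linarith
    have hstep := hNstep x (y k) (sum_sub_totalAverage hn _ _)
    have hle := hNadd (mix (stepMatrix A T) x + (ε * T) • y k)
      (x - mix (stepMatrix A T) x + mix B (y k) - (ε * T) • y k)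
      (fun _ => (T / n * α k) • ∑ i, d i) (-((α k * T) • d))
    have hKD : 0 ≤ K * (α k * ∑ i, ‖d i‖) := by positivity
    change N (r (k + 1) + q (k + 1) - fun _ => totalAverage (r (k + 1) + q (k + 1)) (y (k + 1)))
      (y (k + 1)) ≤ l * N x (y k) + (K + K * (2 * T)) * (α k * ∑ i, ‖d i‖)
    rw [e1, e2]
    linarith
  · set x := r k + q k - fun _ => totalAverage (r k + q k) (y k) with hx
    have hlow := hNlow x (y k) (sum_sub_totalAverage hn _ _)
    have hB1 : ∀ i j, B i j ≤ 1 := fun i j => by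
      rw [← hB.col_sum j]
      exact Finset.single_le_sum (f := fun i => B i j) (fun i _ => hB.nonneg i j)
        (Finset.mem_univ i)
    have e : auxPoint B (r k) (q k) (y k) i - totalAverage (r k + q k) (y k)
        = x i + ∑ j, B i j • y k j := by
      simp only [auxPoint, hx, Pi.add_apply, Pi.sub_apply]
      abel
    have g1 : ‖x i‖ ≤ ∑ i, ‖x i‖ :=
      Finset.single_le_sum (f := fun i => ‖x i‖) (fun _ _ => norm_nonneg _) (Finset.mem_univ i)
    have g2 : ‖∑ j, B i j • y k j‖ ≤ ∑ j, ‖y k j‖ := by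
      refine (norm_sum_le _ _).trans (Finset.sum_le_sum fun j _ => ?_)
      rw [norm_smul, Real.norm_of_nonneg (hB.nonneg i j)]
      exact mul_le_of_le_one_left (norm_nonneg _) (hB1 i j)
    have g3 : 0 ≤ K * (2 * T) * N x (y k) := mul_nonneg (by positivity) (hN0 _ _)
    rw [e]
    refine (norm_add_le _ _).trans ?_
    linarith

/-- The positions follow the sums `r + q` because `0 < T < 2`. -/
theorem IsTrajectory.tendsto_position (h : IsTrajectory A B T ε α f r q y) (hT : 0 < T)
    (hT2 : T < 2) {x : Vec s} {i : Fin n}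
    (hx : Tendsto (fun k => r k i + q k i) atTop (𝓝 x)) :
    Tendsto (fun k => r k i) atTop (𝓝 x) := by
  rw [tendsto_iff_norm_sub_tendsto_zero] at hx ⊢
  refine tendsto_zero_of_contraction (l := |1 - T|) (b := fun k => T * ‖r k i + q k i - x‖)
    (abs_nonneg _) (abs_lt.2 ⟨by linarith, by linarith⟩) (fun _ => norm_nonneg _)
    (by simpa using hx.const_mul T) fun k => ?_
  have e : r (k + 1) i - x = (1 - T) • (r k i - x) + T • (r k i + q k i - x) := by
    rw [h.position]
    module
  rw [e]
  refine (norm_add_le _ _).trans_eq ?_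
  rw [norm_smul, norm_smul, Real.norm_eq_abs, Real.norm_of_nonneg hT.le]

end Reduction

end SurplusOpt

end

/-! ### Assembly. -/

theorem mainTheorem1 (n : ℕ) (A B : Matrix (Fin n) (Fin n) ℝ) (T : ℝ)
    (hA : ∀ i j, 0 ≤ A i j) (hconn : SurplusOpt.StronglyConnected A)
    (hB : SurplusOpt.IsSurplusWeight A B)
    (hT : 0 < T) (hT2 : T < 2) (hTA : ∀ i, 0 < 1 / T - ∑ j, A i j) :
    ∃ ε₀ : ℝ, 0 < ε₀ ∧ ∀ ε : ℝ, 0 < ε → ε < ε₀ → (∀ i, ε < 1 / T - ∑ j, A i j) →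
      ∀ (s : ℕ) (f : Fin n → SurplusOpt.Vec s → ℝ) (α : ℕ → ℝ)
        (r q y : ℕ → Fin n → SurplusOpt.Vec s),
        (∀ i, Differentiable ℝ (f i)) →
        (∀ i, ConvexOn ℝ Set.univ (f i)) →
        (∀ i, (SurplusOpt.gradZeros (f i)).Nonempty ∧
          Bornology.IsBounded (SurplusOpt.gradZeros (f i))) →
        (∀ k, 0 < α k) → (∀ k, α (k + 1) ≤ α k) →
        Tendsto (fun N => ∑ k ∈ Finset.range N, α k) atTop atTop →
        Summable (fun k => α k ^ 2) →
        SurplusOpt.IsTrajectory A B T ε α f r q y →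
        (∀ i j, Tendsto (fun k => r k i - r k j) atTop (𝓝 0)) ∧
        (∀ i, Tendsto (fun k => q k i) atTop (𝓝 0)) ∧
        ∃ x ∈ SurplusOpt.optimalSet f, ∀ i, Tendsto (fun k => r k i) atTop (𝓝 x) := by
  rcases Nat.eq_zero_or_pos n with rfl | hn
  · refine ⟨1, one_pos, ?_⟩
    intro ε _ _ _ s f α r q y _ _ _ _ _ _ _ _
    exact ⟨fun i => i.elim0, fun i => i.elim0, 0,
      fun z => by simp [SurplusOpt.teamObjective], fun i => i.elim0⟩
  obtain ⟨δ₀, hδ₀, H⟩ := SurplusOpt.exists_joint_norm hn hA hconn hB hT hTA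
  -- The gain of the reduced iteration is εT.
  refine ⟨δ₀ / T, div_pos hδ₀ hT, ?_⟩
  intro ε hε hεlt _ s f α r q y hd hc hX hα _ hdiv hsq htraj
  obtain ⟨l, K, hl0, hl1, hK, HN⟩ := H (ε * T) (mul_pos hε hT) ((lt_div_iff₀ hT).1 hεlt)
  obtain ⟨N, hN0, hNadd, hNstep, hNlow, hNup⟩ := HN (SurplusOpt.Vec s)
  have hα0 : Tendsto α atTop (𝓝 0) := by
    have h1 := hsq.tendsto_atTop_zero.sqrt
    simpa only [Real.sqrt_sq (hα _).le, Real.sqrt_zero] using h1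
  have hdesc := htraj.exists_perturbedDescent hn hB hT hα hK hN0 hNadd hNstep hNlow hNup
  have hlim0 := hdesc.tendsto_disagreement hl0 hl1 hα hα0
  obtain ⟨x, hx, hXx⟩ := hdesc.exists_tendsto hn (by positivity) hl0 hl1 (by positivity) hd hc hX
    hα hα0 hdiv hsq
  have hsum : ∀ i, Tendsto (fun k => r k i + q k i) atTop (𝓝 x) := by
    intro i
    have hdiff : Tendsto (fun k => r k i + q k i - SurplusOpt.totalAverage (r k + q k) (y k))
        atTop (𝓝 0) := by
      have hKlim := hlim0.const_mul K
      rw [mul_zero] at hKlim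
      refine squeeze_zero_norm (fun k => ?_) hKlim
      have h1 := hNlow _ (y k) (SurplusOpt.sum_sub_totalAverage hn (r k + q k) (y k))
      have h2 : 0 ≤ ∑ i, ‖y k i‖ := Finset.sum_nonneg fun _ _ => norm_nonneg _
      have h3 := Finset.single_le_sum (f := fun i =>
        ‖(r k + q k - fun _ => SurplusOpt.totalAverage (r k + q k) (y k) : Fin n → SurplusOpt.Vec s) i‖)
        (fun _ _ => norm_nonneg _) (Finset.mem_univ i)
      simp only [Pi.sub_apply, Pi.add_apply] at h1 h3
      linarith
    simpa using hdiff.add hXx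
  have hr : ∀ i, Tendsto (fun k => r k i) atTop (𝓝 x) := fun i =>
    htraj.tendsto_position hT hT2 (hsum i)
  refine ⟨fun i j => by simpa using (hr i).sub (hr j), fun i => ?_, x, hx, hr⟩
  simpa using (hsum i).sub (hr i)
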